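/- **Setting.** A transmitter with $L$ antennas serves $K$ users with $G$ receive antennas each. The channel matrices $H_k\in\mathbb C^{G\times L}$, $k\in[K]$, have i.i.d. $\mathcal{CN}(0,1)$ entries and are known to the transmitter; user $k$ receives $y_k=H_kx+z_k$. Let $t\ge 0$ and $t+1\le\Omega\le K$. Each of $N$ files $W_n$ is split into $\binom Kt$ packets $W_{n,P}$, $P\subseteq[K]$, $|P|=t$, and user $k$ caches all packets with $k\in P$. Each user $k$ then requests one file $W_{d_k}$. Put $$\beta_0=\frac{t+1}{\gcd(t+1,\Omega)},\qquad B_0=\frac{\Omega}{\gcd(t+1,\Omega)},\qquad S_0=\binom{\Omega}{t+1}\Big/B_0 .$$ For a set $\mathcal K$ of $\Omega$ users, a *base schedule* is a partition of $\{T\subseteq\mathcal K:|T|=t+1\}$ into $S_0$ columns such that the sets in each column cover $\mathcal K$ and each user $k\in\mathcal K$ lies in exactly $\beta_0$ sets of each column. **Theorem.** Let $\delta,\eta\ge1$ be integers such that $\delta S_0/\eta$ is an integer and $$\eta\le\min\left(\frac{L S_0}{1+(\Omega-t-1)S_0\beta_0},\ \frac{G}{\beta_0}\right).$$ Then every $\mathcal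 K$ with $|\mathcal K|=\Omega$ has a base schedule, and for any choice of base schedules the following is a linear multicast coded-caching scheme in which every target user decodes $\beta=\eta\beta_0$ streams in each transmission. Split every packet into $\delta\binom{K-t-1}{\Omega-t-1}$ subpackets. For each $\mathcal K$, concatenate $\delta$ copies of its base schedule to a table of $\delta S_0$ columns and cut the table into $\delta S_0/\eta$ blocks of $\eta$ consecutive columns; each block is one transmission. The entry $T$ of copy $i$ of the table of $\mathcal K$ stands for the codeword $\bigoplus_{k\in T}W^{q}_{d_k,T\setminus\{k\}}$, a bitwise XOR of $t+1$ subpackets, where the numbering $q=q(T,\mathcal K,i)$ is such that for each $T$ the map $(\mathcal K,i)\mapsto q$, for $\mathcal K\supseteq T$ and $i\in[\delta]$, is a bijection onto the set of subpacket indices; such numberings exist, and any of them may be used. Precisely: 1. In every transmission to $\mathcal K$ all codewords are indexed by sets $T\subseteq\mathcal K$ with $|T|=t+1$, and each $k\in\mathcal K$ belongs to exactly $\beta=\eta\beta_0$ of them. 2. Almost surely with respect to the channels, for every transmission there are transmit beamformers $w_j\in\mathbb C^L$, one for each codeword $j$ of the block, such that for every target user $k\in\mathcal K$ and every codeword $j$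 of the block whose index set contains $k$ there is a receive vector $u_{k,j}\in\mathbb C^G$ with $$u_{k,j}^{H}\Big(H_k\sum_i w_i s_i+z\Big)=s_j+u_{k,j}^{H}z$$ for all symbols $s_i$ (one for each codeword $i$ of the block) and all noise vectors $z$; that is, each target user decodes its $\beta$ streams free of interference with a linear receiver. 3. For all requests, each user $k$ obtains from each codeword whose index set contains $k$, together with its cache, the subpacket $W^{q}_{d_k,T\setminus\{k\}}$; over all transmissions these subpackets are pairwise distinct and none is cached by $k$, and altogether they and the cache determine the requested file $W_{d_k}$. -/

import Mathlib

open MeasureTheory ProbabilityTheory Matrix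

/-- `β₀ = (t+1) / gcd(t+1, Ω)` (the division is exact). -/
def beta0 (t Ω : ℕ) : ℕ := (t + 1) / Nat.gcd (t + 1) Ω

/-- `B₀ = Ω / gcd(t+1, Ω)` (the division is exact). -/
def B0 (t Ω : ℕ) : ℕ := Ω / Nat.gcd (t + 1) Ω

/-- `S₀ = binom(Ω, t+1) / B₀` (the division is exact). -/
def S0 (t Ω : ℕ) : ℕ := Nat.choose Ω (t + 1) / B0 t Ω

/-- Packet indices: the sets of `t` users out of `K`. -/
abbrev PacketIdx (K t : ℕ) : Type := {P : Finset (Fin K) // P.card = t}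

/-- Codeword indices: the sets of `t + 1` users out of `K`. -/
abbrev CodewordIdx (K t : ℕ) : Type := {T : Finset (Fin K) // T.card = t + 1}

/-- Target user sets: the sets of `Ω` users out of `K`. -/
abbrev TargetSet (K Ω : ℕ) : Type := {A : Finset (Fin K) // A.card = Ω}

/-- The packet index `T \ {k}` for a codeword index `T` and a user `k ∈ T`. -/
def CodewordIdx.packet {K t : ℕ} (T : CodewordIdx K t) (k : Fin K) (hk : k ∈ T.1) :
    PacketIdx K t :=
  ⟨T.1.erase k, by rw [Finset.card_erase_of_mem hk, T.2]; rfl⟩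

/-- A base schedule for the target set `A`: a partition of the codeword indices `T ⊆ A` into
`S₀` columns, each of which covers `A` and contains every user of `A` exactly `β₀` times. -/
structure BaseSchedule {K : ℕ} (t Ω : ℕ) (A : TargetSet K Ω) where
  column : Fin (S0 t Ω) → Finset (CodewordIdx K t)
  subset_target : ∀ s, ∀ T ∈ column s, T.1 ⊆ A.1
  partition : ∀ T : CodewordIdx K t, T.1 ⊆ A.1 → ∃! s, T ∈ column s
  covers : ∀ s, (column s).biUnion (fun T => T.1) = A.1
  regular : ∀ s, ∀ k ∈ A.1, ((column s).filter (fun T => k ∈ T.1)).card = beta0 t Ω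

/-- The number of subpackets into which each packet is split: `δ · binom(K-t-1, Ω-t-1)`. -/
def numSub (K t Ω δ : ℕ) : ℕ := δ * Nat.choose (K - t - 1) (Ω - t - 1)

/-- The free choices of the delivery scheme: a base schedule for every target set, and a numbering
of the subpackets. The copy number `d` of the codeword `T` sent to the target set `A` carries the
subpackets with the super-index `label T A d`; for a fixed `T` every super-index is used for
exactly one pair `(A, d)` with `T ⊆ A`, so that no subpacket is repeated. -/
structure DeliveryPlan (K t Ω δ : ℕ) where
  base : ∀ A : TargetSet K Ω, BaseSchedule t Ω A
  label : CodewordIdx K t → TargetSet K Ω → Fin δ → Fin (numSub K t Ω δ)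
  label_bijOn : ∀ T : CodewordIdx K t,
    Set.BijOn (fun x : TargetSet K Ω × Fin δ => label T x.1 x.2) {x | T.1 ⊆ x.1.1} Set.univ

/-- The codewords of one transmission. Concatenating `δ` copies of the base schedule gives a table
with `δ S₀` columns, in which column `s` of copy `d` has the (zero-based) number `S₀ d + s`; this
table is cut into `δ S₀ / η` blocks of `η` consecutive columns, and the result is the set of all
codewords `(d, T)` in block number `r`. -/
def DeliveryPlan.block {K t Ω δ : ℕ} (p : DeliveryPlan K t Ω δ) (η : ℕ) (A : TargetSet K Ω)
    (r : Fin (δ * S0 t Ω / η)) : Finset (Fin δ × CodewordIdx K t) :=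
  ((Finset.univ : Finset (Fin δ × Fin (S0 t Ω))).filter
      (fun c => (S0 t Ω * c.1.1 + c.2.1) / η = r.1)).biUnion
    (fun c => ((p.base A).column c.2).image (fun T => (c.1, T)))

/-- A subpacket consists of `b` bits; addition is the bitwise XOR. -/
abbrev Bits (b : ℕ) : Type := Fin b → ZMod 2

/-- A file: one `Q`-tuple of subpackets for every packet index. -/
abbrev FileData (K t Q b : ℕ) : Type := PacketIdx K t → Fin Q → Bits b

/-- What user `k` stores in the placement phase: of every file, the packets `P` with `k ∈ P`. -/
abbrev CacheData (K N t Q b : ℕ) (k : Fin K) : Type :=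
  Fin N → {P : PacketIdx K t // k ∈ P.1} → Fin Q → Bits b

/-- The cache contents of user `k` for the library `W` of `N` files. -/
def cacheOf {K N t Q b : ℕ} (W : Fin N → FileData K t Q b) (k : Fin K) :
    CacheData K N t Q b k :=
  fun n P q => W n P.1 q

/-- The XOR codeword for the users in `T` (copy `d`, target set `A`): the XOR over `k ∈ T` of the
subpackets with packet index `T \ {k}` of the files requested by the users `k`. -/
def DeliveryPlan.codeword {K t Ω δ N b : ℕ} (p : DeliveryPlan K t Ω δ)
    (W : Fin N → FileData K t (numSub K t Ω δ) b) (dem : Fin K → Fin N)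
    (A : TargetSet K Ω) (d : Fin δ) (T : CodewordIdx K t) : Bits b :=
  ∑ k : {k // k ∈ T.1}, W (dem k.1) (T.packet k.1 k.2) (p.label T A d)

/-- The streams for user `k`: all `(A, r, (d, T))` such that the codeword `(d, T)` is sent in the
block `r` for the target set `A`, and `k ∈ T`. -/
abbrev DeliveryPlan.Stream {K t Ω δ : ℕ} (p : DeliveryPlan K t Ω δ) (η : ℕ) (k : Fin K) : Type :=
  {y : TargetSet K Ω × Fin (δ * S0 t Ω / η) × (Fin δ × CodewordIdx K t) //
    y.2.2 ∈ p.block η y.1 y.2.1 ∧ k ∈ y.2.2.2.1}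

/-- The (packet index, super-index) of the subpacket that a stream carries for user `k`. -/
def DeliveryPlan.subpacketOf {K t Ω δ : ℕ} (p : DeliveryPlan K t Ω δ) {η : ℕ} {k : Fin K}
    (y : p.Stream η k) : PacketIdx K t × Fin (numSub K t Ω δ) :=
  (y.1.2.2.2.packet k y.2.2, p.label y.1.2.2.2 y.1.1 y.1.2.2.1)

/-- The XOR codeword sent on a stream of user `k`. -/
def DeliveryPlan.codewordOf {K t Ω δ N b : ℕ} (p : DeliveryPlan K t Ω δ) {η : ℕ} {k : Fin K}
    (W : Fin N → FileData K t (numSub K t Ω δ) b) (dem : Fin K → Fin N)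
    (y : p.Stream η k) : Bits b :=
  p.codeword W dem y.1.1 y.1.2.2.1 y.1.2.2.2

/-- The law `CN(0,1)`: independent real and imaginary parts of mean `0` and variance `1/2`. -/
noncomputable def complexGaussian : Measure ℂ :=
  Measure.map (fun x : ℝ × ℝ => (x.1 : ℂ) + (x.2 : ℂ) * Complex.I)
    ((gaussianReal 0 (1 / 2)).prod (gaussianReal 0 (1 / 2)))

/-- The joint law of the channel matrices of `K` users with `G` receive antennas each and `L`
transmit antennas: all entries are i.i.d. `CN(0,1)`. -/
noncomputable def channelLaw (K G L : ℕ) : Measure (Fin K → Fin G → Fin L → ℂ) :=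
  Measure.pi fun _ => Measure.pi fun _ => Measure.pi fun _ => complexGaussian

/-- The vector `u` is a linear receiver that decodes the stream `x₀` free of interference: if the
transmit vector is the superposition of the symbols `sym x` (the modulated codewords) with the
beamformers `w x`, `x ∈ C`, and the received vector is `y = H (∑ x ∈ C, sym x • w x) + z`, then
`uᴴ y` is the symbol `sym x₀` plus the filtered noise `uᴴ z`. -/
def DecodesLinearly {G L : ℕ} {ι : Type} (H : Matrix (Fin G) (Fin L) ℂ) (C : Finset ι)
    (w : ι → Fin L → ℂ) (u : Fin G → ℂ) (x₀ : ι) : Prop :=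
  ∀ (sym : ι → ℂ) (z : Fin G → ℂ),
    star u ⬝ᵥ (H *ᵥ (∑ x ∈ C, sym x • w x) + z) = sym x₀ + star u ⬝ᵥ z

/-!
Base schedules come from Baranyai's argument: the points of `𝒦` are inserted one at a time into an
initially empty family of sets. Each step spreads the new point over the family as a fractional
incidence vector whose sums over classes and over equal traces are integers, and Hall's theorem
rounds this vector without changing the sums.

A block contains `β = η β₀` codewords for each target user, so that user can separate its streams
with `β` of its antennas, provided that every codeword is nulled at those antennas of the
`Ω - t - 1` other users and that the resulting `β × β` matrix of gains is invertible. Zero-forcing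
beamformers do the nulling, and the determinant of the gains is a polynomial in the channels and in
the free parameters of the beamformers, so for almost all channels it suffices to find one point
where it does not vanish. The codewords of one user get different coordinates as beamformers, and
Hall's theorem provides sparse channels to the other users that are nulled at these coordinates; the
hypothesis on `L` is the resulting count, since a block of consecutive columns repeats a set `T` at
most `⌈η / S₀⌉` times.
-/

open scoped Finset

section Rounding

variable {E 𝕜 : Type*} [Fintype E] [Field 𝕜] [LinearOrder 𝕜] [IsStrictOrderedRing 𝕜]

theorem exists_injective_of_sum_eq_one {S : Type*} [Fintype S] {y : E → S → 𝕜}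
    (hy : ∀ e s, 0 ≤ y e s) (hrow : ∀ e, ∑ s, y e s = 1) (hcol : ∀ s, ∑ e, y e s ≤ 1) :
    ∃ f : E → S, f.Injective ∧ ∀ e, y e (f e) ≠ 0 := by
  classical
  let support (e : E) : Finset S := {s | y e s ≠ 0}
  have hall (A : Finset E) : #A ≤ #(A.biUnion support) := by
    have h : (#A : 𝕜) ≤ #(A.biUnion support) := by
      calc (#A : 𝕜) = ∑ e ∈ A, ∑ s, y e s := by simp [hrow]
        _ = ∑ e ∈ A, ∑ s ∈ A.biUnion support, y e s := by
            refine Finset.sum_congr rfl fun e he ↦ (Finset.sum_subset (Finset.subset_univ _)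
              fun s _ hs ↦ ?_).symm
            by_contra h
            exact hs (Finset.mem_biUnion.2 ⟨e, he, by simpa [support] using h⟩)
        _ = ∑ s ∈ A.biUnion support, ∑ e ∈ A, y e s := Finset.sum_comm
        _ ≤ ∑ _s ∈ A.biUnion support, 1 := Finset.sum_le_sum fun s _ ↦
            (Finset.sum_le_univ_sum_of_nonneg fun e ↦ hy e s).trans (hcol s)
        _ = #(A.biUnion support) := by simp
    exact_mod_cast h
  obtain ⟨f, hf, hmem⟩ := (Finset.all_card_le_biUnion_card_iff_exists_injective support).1 hall
  exact ⟨f, hf, fun e ↦ by simpa [support] using hmem e⟩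

theorem exists_assignment_of_sum_eq {S : Type*} [Fintype S] [DecidableEq S] {y : E → S → 𝕜}
    {c : S → ℕ} (hy : ∀ e s, 0 ≤ y e s) (hrow : ∀ e, ∑ s, y e s = 1)
    (hcol : ∀ s, ∑ e, y e s = c s) :
    ∃ f : E → S, (∀ e, y e (f e) ≠ 0) ∧ ∀ s, #{e | f e = s} = c s := by
  have sum_slots (e : E) (s : S) : ∑ _i : Fin (c s), y e s / c s = y e s := by
    rcases eq_or_ne (c s) 0 with hs | hs
    · have hzero : ∑ e', y e' s = 0 := by rw [hcol, hs, Nat.cast_zero]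
      rw [(Finset.sum_eq_zero_iff_of_nonneg fun e' _ ↦ hy e' s).1 hzero e (Finset.mem_univ e)]
      simp
    · simp [mul_div_cancel₀, hs]
  -- Divide `s` into `c s` slots of capacity `1`, and spread the weight `y e s` evenly over them.
  obtain ⟨g, hg, hmem⟩ := exists_injective_of_sum_eq_one (S := Σ s, Fin (c s))
    (y := fun e σ ↦ y e σ.1 / c σ.1) (fun e σ ↦ div_nonneg (hy _ _) (Nat.cast_nonneg _))
    (fun e ↦ by simp only [Fintype.sum_sigma, sum_slots, hrow])
    (fun σ ↦ by rw [← Finset.sum_div, hcol]; exact div_self_le_one _)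
  have hcard : Fintype.card E = Fintype.card (Σ s, Fin (c s)) := by
    have h : (Fintype.card E : 𝕜) = ∑ s, (c s : 𝕜) := by
      simp_rw [← hcol]
      rw [Finset.sum_comm]
      simp [hrow]
    rw [Fintype.card_sigma]
    simpa using (by exact_mod_cast h : Fintype.card E = ∑ s, c s)
  have hbij : g.Bijective := (Fintype.bijective_iff_injective_and_card g).2 ⟨hg, hcard⟩
  refine ⟨fun e ↦ (g e).1, fun e ↦ (div_ne_zero_iff.1 (hmem e)).1, fun s ↦ ?_⟩
  calc #{e | (g e).1 = s} = #{σ : Σ s, Fin (c s) | σ.1 = s} :=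
        Finset.card_bijective g hbij (by simp)
    _ = #(Finset.univ.map (Function.Embedding.sigmaMk (β := fun s ↦ Fin (c s)) s)) := by
        congr 1
        ext ⟨s', i⟩
        simp only [Finset.mem_filter, Finset.mem_univ, true_and, Finset.mem_map,
          Function.Embedding.sigmaMk_apply]
        exact ⟨by rintro rfl; exact ⟨i, rfl⟩, fun ⟨j, hj⟩ ↦ (congrArg Sigma.fst hj).symm⟩
    _ = c s := by simp

/- Each `e` is assigned to its class under `q` with weight `x e` and to its class under `p` with
weight `1 - x e`; the chosen set consists of the elements assigned to a class under `q`. -/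
theorem exists_finset_card_fiber_eq_sum {ι κ : Type*} [Finite ι] [Finite κ] [DecidableEq ι]
    [DecidableEq κ] (p : E → ι) (q : E → κ) {x : E → 𝕜} (h0 : ∀ e, 0 ≤ x e) (h1 : ∀ e, x e ≤ 1)
    (hp : ∀ i, ∃ a : ℕ, ∑ e with p e = i, x e = a) (hq : ∀ j, ∃ b : ℕ, ∑ e with q e = j, x e = b) :
    ∃ F : Finset E, (∀ e ∈ F, x e ≠ 0) ∧
      (∀ i, (#{e ∈ F | p e = i} : 𝕜) = ∑ e with p e = i, x e) ∧
      ∀ j, (#{e ∈ F | q e = j} : 𝕜) = ∑ e with q e = j, x e := by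
  have := Fintype.ofFinite ι
  have := Fintype.ofFinite κ
  choose a ha using hp
  choose b hb using hq
  have a_le (i : ι) : a i ≤ #{e | p e = i} := by
    have h : (a i : 𝕜) ≤ #{e | p e = i} := by
      rw [← ha, ← nsmul_one, ← Finset.sum_const]
      exact Finset.sum_le_sum fun e _ ↦ h1 e
    exact_mod_cast h
  let y (e : E) : ι ⊕ κ → 𝕜 :=
    Sum.elim (fun i ↦ if p e = i then 1 - x e else 0) fun j ↦ if q e = j then x e else 0
  obtain ⟨f, hf, hcard⟩ := exists_assignment_of_sum_eq (y := y)
    (c := Sum.elim (fun i ↦ #{e | p e = i} - a i) b)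
    (by rintro e (i | j) <;> simp only [y, Sum.elim_inl, Sum.elim_inr] <;> split_ifs <;>
          simp [h0, h1])
    (fun e ↦ by simp [y])
    (by
      rintro (i | j)
      · simp [y, ← Finset.sum_filter, a_le, ha]
      · simp [y, ← Finset.sum_filter, hb])
  have left_iff (e : E) (i : ι) : f e = .inl i ↔ p e = i ∧ ¬(f e).isRight := by
    have := hf e
    cases h : f e <;> simp_all [y]
  have right_iff (e : E) (j : κ) : f e = .inr j ↔ (f e).isRight ∧ q e = j := by
    have := hf e
    cases h : f e <;> simp_all [y]
  refine ⟨Finset.univ.filter fun e ↦ (f e).isRight, fun e he ↦ ?_, fun i ↦ ?_, fun j ↦ ?_⟩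
  · have := hf e
    cases h : f e <;> simp_all [y]
  · have hsplit := Finset.card_filter_add_card_filter_not (s := {e | p e = i})
      fun e ↦ (f e).isRight = true
    simp only [Finset.filter_filter, ← left_iff, hcard, Sum.elim_inl] at hsplit
    simp only [ha, Finset.filter_filter, and_comm, Nat.cast_inj]
    have := a_le i
    omega
  · simp only [hb, Finset.filter_filter, ← right_iff, hcard, Sum.elim_inr]

end Rounding

section Baranyai

variable {E ι α : Type*} [Fintype E] [DecidableEq ι] [DecidableEq α]
  {n h β : ℕ} {cls : E → ι} {U : Finset α} {φ : E → Finset α}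

/-- A stage of Baranyai's induction. The elements of `E` stand for the `h`-element subsets of an
`n`-element set containing `U`, distributed into classes by `cls`, of which only the traces `φ e`
on `U` have been determined: every `S ⊆ U` is the trace of the right number of `h`-element sets, and
every class contains every point of `U` exactly `β` times. -/
structure IsTraceFamily (n h β : ℕ) (cls : E → ι) (U : Finset α) (φ : E → Finset α) : Prop where
  subset (e : E) : φ e ⊆ U
  card_le (e : E) : #(φ e) ≤ h
  card_fiber : ∀ S ⊆ U, #S ≤ h → #{e | φ e = S} = (n - #U).choose (h - #S)
  card_class (i : ι) : ∀ k ∈ U, #{e | cls e = i ∧ k ∈ φ e} = β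

theorem card_fiber_insert_of_mem [DecidableEq E] {v : α} (hvφ : ∀ e, v ∉ φ e) (F : Finset E)
    {S : Finset α} (hvS : v ∈ S) :
    #{e | (if e ∈ F then insert v (φ e) else φ e) = S} = #{e ∈ F | φ e = S.erase v} := by
  congr 1
  ext e
  by_cases he : e ∈ F
  · simp only [Finset.mem_filter, Finset.mem_univ, he, if_true, true_and]
    exact ⟨fun h ↦ by rw [← h, Finset.erase_insert (hvφ e)],
      fun h ↦ by rw [h, Finset.insert_erase hvS]⟩
  · simp only [Finset.mem_filter, Finset.mem_univ, he, if_false, true_and, false_and, iff_false]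
    exact fun h ↦ hvφ e (h ▸ hvS)

theorem card_fiber_insert_of_notMem [DecidableEq E] {v : α} (F : Finset E) {S : Finset α}
    (hvS : v ∉ S) :
    #{e | (if e ∈ F then insert v (φ e) else φ e) = S} + #{e ∈ F | φ e = S} = #{e | φ e = S} := by
  have hne (e : E) : insert v (φ e) ≠ S := fun h ↦ hvS (h ▸ Finset.mem_insert_self _ _)
  rw [← Finset.card_filter_add_card_filter_not (s := {e | φ e = S}) fun e ↦ e ∉ F]
  simp only [Finset.filter_filter]
  congr 2 <;> ext e <;> by_cases he : e ∈ F <;> simp [he, hne]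

namespace IsTraceFamily

theorem deficiency_le (hφ : IsTraceFamily n h β cls U φ) (e : E) : h - #(φ e) ≤ n - #U := by
  rw [← Nat.choose_ne_zero_iff, ← hφ.card_fiber _ (hφ.subset e) (hφ.card_le e)]
  exact (Finset.card_pos.2 ⟨e, by simp⟩).ne'

theorem sum_card_class (hφ : IsTraceFamily n h β cls U φ) (i : ι) :
    ∑ e with cls e = i, #(φ e) = #U * β := by
  calc ∑ e with cls e = i, #(φ e) = ∑ e with cls e = i, ∑ k ∈ U, if k ∈ φ e then 1 else 0 := by
        simp only [Finset.sum_boole, Finset.filter_mem_eq_inter,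
          Finset.inter_eq_right.2 (hφ.subset _), Nat.cast_id]
    _ = ∑ k ∈ U, #{e | cls e = i ∧ k ∈ φ e} := by
        rw [Finset.sum_comm]
        simp only [Finset.sum_boole, Finset.filter_filter, Nat.cast_id]
    _ = #U * β := by rw [Finset.sum_congr rfl (hφ.card_class i), Finset.sum_const, smul_eq_mul]

theorem sum_deficiency_class (hφ : IsTraceFamily n h β cls U φ) {i : ι}
    (hcls : #{e | cls e = i} * h = n * β) :
    ∑ e with cls e = i, (h - #(φ e)) = (n - #U) * β := by
  rw [Finset.sum_tsub_distrib _ fun e _ ↦ hφ.card_le e, Finset.sum_const, smul_eq_mul, hcls,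
    hφ.sum_card_class, tsub_mul]

theorem dvd_card_fiber_mul_deficiency (hφ : IsTraceFamily n h β cls U φ) (hU : #U < n)
    (S : Finset α) : n - #U ∣ #{e | φ e = S} * (h - #S) := by
  rcases (Finset.univ.filter fun e ↦ φ e = S).eq_empty_or_nonempty with hS | ⟨e, he⟩
  · simp [hS]
  obtain rfl := (Finset.mem_filter.1 he).2
  rw [hφ.card_fiber _ (hφ.subset e) (hφ.card_le e)]
  obtain ⟨m, hm⟩ : ∃ m, n - #U = m + 1 := ⟨n - #U - 1, by omega⟩
  obtain hj | ⟨j, hj⟩ : h - #(φ e) = 0 ∨ ∃ j, h - #(φ e) = j + 1 := by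
    cases h - #(φ e) <;> simp
  · simp [hj]
  · rw [hm, hj, ← Nat.add_one_mul_choose_eq]
    exact dvd_mul_right _ _

theorem exists_insertion_set [Finite ι] [Finite α] (hφ : IsTraceFamily n h β cls U φ) (hU : #U < n)
    (hcls : ∀ i, #{e | cls e = i} * h = n * β) :
    ∃ F : Finset E, (∀ e ∈ F, #(φ e) < h) ∧ (∀ i, #{e ∈ F | cls e = i} = β) ∧
      ∀ S, #{e ∈ F | φ e = S} * (n - #U) = #{e | φ e = S} * (h - #S) := by
  have hm : ((n - #U : ℕ) : ℚ) ≠ 0 := by exact_mod_cast (Nat.sub_pos_of_lt hU).ne'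
  let x (e : E) : ℚ := (h - #(φ e) : ℕ) / (n - #U : ℕ)
  have sum_class (i : ι) : ∑ e with cls e = i, x e = β := by
    rw [← Finset.sum_div, ← Nat.cast_sum, hφ.sum_deficiency_class (hcls i), Nat.cast_mul,
      mul_div_cancel_left₀ _ hm]
  have sum_fiber (S : Finset α) :
      ∑ e with φ e = S, x e = (#{e | φ e = S} * (h - #S) : ℕ) / (n - #U : ℕ) := by
    rw [← Finset.sum_div, ← Nat.cast_sum, ← smul_eq_mul, ← Finset.sum_const]
    congr 2
    exact Finset.sum_congr rfl fun e he ↦ by rw [(Finset.mem_filter.1 he).2]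
  obtain ⟨F, hF, hF_class, hF_fiber⟩ := exists_finset_card_fiber_eq_sum cls φ (x := x)
    (fun e ↦ by positivity)
    (fun e ↦ div_le_one_of_le₀ (by exact_mod_cast hφ.deficiency_le e) (Nat.cast_nonneg _))
    (fun i ↦ ⟨β, sum_class i⟩)
    (fun S ↦ ⟨_, by rw [sum_fiber, ← Nat.cast_div (hφ.dvd_card_fiber_mul_deficiency hU S) hm]⟩)
  refine ⟨F, fun e he ↦ ?_, fun i ↦ ?_, fun S ↦ ?_⟩
  · have := hF e he
    contrapose! this
    simp [x, Nat.sub_eq_zero_of_le this]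
  · exact_mod_cast (hF_class i).trans (sum_class i)
  · have := (hF_fiber S).trans (sum_fiber S)
    rw [eq_div_iff hm] at this
    exact_mod_cast this

theorem card_fiber_insert_point [DecidableEq E] (hφ : IsTraceFamily n h β cls U φ) (hU : #U < n)
    {v : α} (hv : v ∉ U) {F : Finset E}
    (hF_fiber : ∀ S, #{e ∈ F | φ e = S} * (n - #U) = #{e | φ e = S} * (h - #S))
    {S : Finset α} (hS : S ⊆ insert v U) (hSh : #S ≤ h) :
    #{e | (if e ∈ F then insert v (φ e) else φ e) = S} =
      (n - #(insert v U)).choose (h - #S) := by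
  obtain ⟨m, hm⟩ : ∃ m, n - #U = m + 1 := ⟨n - #U - 1, by omega⟩
  rw [Finset.card_insert_of_notMem hv, Nat.sub_add_eq, hm, Nat.add_sub_cancel]
  refine Nat.eq_of_mul_eq_mul_right m.succ_pos ?_
  by_cases hvS : v ∈ S
  · have hSU : S.erase v ⊆ U := Finset.subset_insert_iff.1 hS
    have hS_card := Finset.card_erase_add_one hvS
    have hj : h - #(S.erase v) = h - #S + 1 := by omega
    rw [card_fiber_insert_of_mem (fun e he ↦ hv (hφ.subset e he)) F hvS, Nat.succ_eq_add_one,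
      ← hm, hF_fiber, hφ.card_fiber _ hSU (by omega), hm, hj, ← Nat.add_one_mul_choose_eq,
      mul_comm]
  · have hSU : S ⊆ U := (Finset.subset_insert_iff_of_notMem hvS).1 hS
    have hsplit := congrArg (· * (m + 1)) (card_fiber_insert_of_notMem (φ := φ) F hvS)
    simp only [add_mul] at hsplit
    rw [← hm, hF_fiber, hφ.card_fiber S hSU hSh, hm] at hsplit
    rw [Nat.succ_eq_add_one, Nat.choose_mul_succ_eq, Nat.mul_sub]
    omega

theorem insert_point [DecidableEq E] (hφ : IsTraceFamily n h β cls U φ) (hU : #U < n) {v : α}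
    (hv : v ∉ U) {F : Finset E} (hF : ∀ e ∈ F, #(φ e) < h)
    (hF_class : ∀ i, #{e ∈ F | cls e = i} = β)
    (hF_fiber : ∀ S, #{e ∈ F | φ e = S} * (n - #U) = #{e | φ e = S} * (h - #S)) :
    IsTraceFamily n h β cls (insert v U) fun e ↦ if e ∈ F then insert v (φ e) else φ e where
  subset e := by
    split_ifs
    · exact Finset.insert_subset_insert v (hφ.subset e)
    · exact (hφ.subset e).trans (Finset.subset_insert v U)
  card_le e := by
    split_ifs with he
    · exact (Finset.card_insert_le _ _).trans (hF e he)
    · exact hφ.card_le e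
  card_fiber S := hφ.card_fiber_insert_point hU hv hF_fiber
  card_class i k hk := by
    have hvφ (e : E) : v ∉ φ e := fun he ↦ hv (hφ.subset e he)
    rcases Finset.mem_insert.1 hk with rfl | hkU
    · rw [← hF_class i]
      congr 1
      ext e
      by_cases he : e ∈ F <;> simp [he, hvφ]
    · have hkv : k ≠ v := fun h ↦ hv (h ▸ hkU)
      rw [← hφ.card_class i k hkU]
      congr 1
      ext e
      by_cases he : e ∈ F <;> simp [he, hkv]

end IsTraceFamily

theorem exists_isTraceFamily [Finite ι] [Finite α] (hE : Fintype.card E = n.choose h)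
    (hcls : ∀ i, #{e | cls e = i} * h = n * β) (U : Finset α) (hU : #U ≤ n) :
    ∃ φ : E → Finset α, IsTraceFamily n h β cls U φ := by
  classical
  induction U using Finset.induction_on with
  | empty =>
    refine ⟨fun _ ↦ ∅, fun _ ↦ le_rfl, by simp, fun S hS _ ↦ ?_, by simp⟩
    simp [Finset.subset_empty.1 hS, hE]
  | insert v U hv ih =>
    have hUn : #U < n := by simpa [hv] using hU
    obtain ⟨φ, hφ⟩ := ih hUn.le
    obtain ⟨F, hF, hF_class, hF_fiber⟩ := hφ.exists_insertion_set hUn hcls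
    exact ⟨_, hφ.insert_point hUn hv hF hF_class hF_fiber⟩

theorem exists_coloring_powersetCard [Fintype ι] [Finite α] (A : Finset α) {B : ℕ}
    (hchoose : Fintype.card ι * B = (#A).choose h) (hB : B * h = #A * β) :
    ∃ color : A.powersetCard h → ι, ∀ i, ∀ k ∈ A, #{S | color S = i ∧ k ∈ S.1} = β := by
  have card_class (i : ι) : #{e : ι × Fin B | e.1 = i} = B := by
    rw [← Finset.univ_product_univ, Finset.filter_product_left (· = i), Finset.card_product,
      Finset.filter_eq' Finset.univ i]
    simp
  obtain ⟨φ, hφ⟩ := exists_isTraceFamily (E := ι × Fin B) (cls := Prod.fst) (n := #A) (β := β)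
    (by rw [Fintype.card_prod, Fintype.card_fin, hchoose]) (fun i ↦ by rw [card_class, hB]) A le_rfl
  have hmem (e : ι × Fin B) : φ e ∈ A.powersetCard h := by
    have := hφ.deficiency_le e
    have := hφ.card_le e
    exact Finset.mem_powersetCard.2 ⟨hφ.subset e, by omega⟩
  have hbij : Function.Bijective fun e ↦ (⟨φ e, hmem e⟩ : A.powersetCard h) := by
    refine (Function.bijective_iff_existsUnique _).2 fun ⟨S, hS⟩ ↦ ?_
    obtain ⟨hSA, hSh⟩ := Finset.mem_powersetCard.1 hS
    have hcard := hφ.card_fiber S hSA hSh.le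
    rw [hSh, tsub_self, tsub_self, Nat.choose_zero_right, Finset.card_eq_one] at hcard
    simpa [Finset.eq_singleton_iff_unique_mem, Subtype.ext_iff, ExistsUnique] using hcard
  let ψ : ι × Fin B ≃ A.powersetCard h := .ofBijective _ hbij
  refine ⟨fun S ↦ (ψ.symm S).1, fun i k hk ↦ ?_⟩
  rw [← hφ.card_class i k hk]
  exact Finset.card_equiv ψ.symm fun S ↦ by
    obtain ⟨e, rfl⟩ := ψ.surjective S
    simp [ψ]

end Baranyai

section Schedule

theorem beta0_pos (t Ω : ℕ) : 0 < beta0 t Ω :=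
  Nat.div_pos (Nat.le_of_dvd t.succ_pos (Nat.gcd_dvd_left _ _))
    (Nat.gcd_pos_of_pos_left _ t.succ_pos)

theorem B0_mul_succ (t Ω : ℕ) : B0 t Ω * (t + 1) = Ω * beta0 t Ω := by
  rw [B0, beta0, ← Nat.mul_div_assoc _ (Nat.gcd_dvd_left _ _),
    Nat.div_mul_right_comm (Nat.gcd_dvd_right _ _)]

/- `B₀` divides `β₀ * Ω.choose (t + 1)`, and it is coprime to `β₀`. -/
theorem S0_mul_B0 (t Ω : ℕ) : S0 t Ω * B0 t Ω = Ω.choose (t + 1) := by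
  refine Nat.div_mul_cancel ?_
  obtain rfl | ⟨n, rfl⟩ : Ω = 0 ∨ ∃ n, Ω = n + 1 := by cases Ω <;> simp
  · simp
  have hcoprime : Nat.Coprime (B0 t (n + 1)) (beta0 t (n + 1)) :=
    (Nat.coprime_div_gcd_div_gcd (Nat.gcd_pos_of_pos_left _ t.succ_pos)).symm
  refine hcoprime.dvd_of_dvd_mul_left ⟨n.choose t, Nat.eq_of_mul_eq_mul_left t.succ_pos ?_⟩
  calc (t + 1) * (beta0 t (n + 1) * (n + 1).choose (t + 1))
      = beta0 t (n + 1) * ((n + 1).choose (t + 1) * (t + 1)) := by ring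
    _ = (n + 1) * beta0 t (n + 1) * n.choose t := by rw [← Nat.add_one_mul_choose_eq]; ring
    _ = (t + 1) * (B0 t (n + 1) * n.choose t) := by rw [← B0_mul_succ]; ring

theorem nonempty_baseSchedule {K t Ω : ℕ} (A : TargetSet K Ω) :
    Nonempty (BaseSchedule t Ω A) := by
  classical
  obtain ⟨color, hcolor⟩ := exists_coloring_powersetCard (ι := Fin (S0 t Ω)) (h := t + 1)
    (β := beta0 t Ω) (B := B0 t Ω) A.1 (by rw [Fintype.card_fin, S0_mul_B0, A.2])
    (by rw [B0_mul_succ, A.2])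
  have hmem {T : CodewordIdx K t} (hT : T.1 ⊆ A.1) : T.1 ∈ A.1.powersetCard (t + 1) :=
    Finset.mem_powersetCard.2 ⟨hT, T.2⟩
  let column (s : Fin (S0 t Ω)) : Finset (CodewordIdx K t) :=
    {T | ∃ hT : T.1 ⊆ A.1, color ⟨T.1, hmem hT⟩ = s}
  have mem_column {s T} : T ∈ column s ↔ ∃ hT : T.1 ⊆ A.1, color ⟨T.1, hmem hT⟩ = s := by
    simp [column]
  have regular (s : Fin (S0 t Ω)) (k : Fin K) (hk : k ∈ A.1) :
      #{T ∈ column s | k ∈ T.1} = beta0 t Ω := by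
    rw [← hcolor s k hk]
    refine (Finset.card_bij (fun S _ ↦ ⟨S.1, (Finset.mem_powersetCard.1 S.2).2⟩) ?_ ?_ ?_).symm
    · rintro ⟨S, hS⟩ hSk
      have hSA := (Finset.mem_powersetCard.1 hS).1
      simpa [mem_column, hSA] using hSk
    · exact fun S _ S' _ h ↦ Subtype.ext (Subtype.mk.inj h)
    · intro T hT
      simp only [Finset.mem_filter, mem_column] at hT
      obtain ⟨⟨hTA, rfl⟩, hkT⟩ := hT
      exact ⟨⟨T.1, hmem hTA⟩, by simpa using hkT, rfl⟩
  refine ⟨⟨column, fun s T hT ↦ (mem_column.1 hT).1, fun T hT ↦ ?_, fun s ↦ ?_, regular⟩⟩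
  · exact ⟨_, mem_column.2 ⟨hT, rfl⟩, fun s hs ↦ (mem_column.1 hs).2.symm⟩
  · refine (Finset.biUnion_subset.2 fun T hT ↦ (mem_column.1 hT).1).antisymm fun k hk ↦ ?_
    obtain ⟨T, hT⟩ : Finset.Nonempty {T ∈ column s | k ∈ T.1} := by
      rw [← Finset.card_pos, regular s k hk]
      exact beta0_pos t Ω
    obtain ⟨hT, hkT⟩ := Finset.mem_filter.1 hT
    exact Finset.mem_biUnion.2 ⟨T, hT, hkT⟩

theorem card_targetSet_superset {K t Ω : ℕ} (h : t + 1 ≤ Ω) (T : CodewordIdx K t) :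
    #{A : TargetSet K Ω | T.1 ⊆ A.1} = (K - t - 1).choose (Ω - t - 1) := by
  have hcard := Finset.card_filter_powersetCard_subset T.1 Finset.univ Ω T.1.subset_univ
    (T.2.trans_le h)
  rw [Finset.card_univ, Fintype.card_fin, T.2] at hcard
  rw [Nat.sub_sub, Nat.sub_sub, ← hcard, ← Finset.card_map (Function.Embedding.subtype _)]
  congr 1
  ext A
  simp [Finset.mem_powersetCard, and_comm]

theorem exists_label_bijOn {K t Ω δ : ℕ} (hpos : 0 < numSub K t Ω δ) (h : t + 1 ≤ Ω)
    (T : CodewordIdx K t) :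
    ∃ f : TargetSet K Ω × Fin δ → Fin (numSub K t Ω δ),
      Set.BijOn f {x | T.1 ⊆ x.1.1} Set.univ := by
  have : Nonempty (Fin (numSub K t Ω δ)) := ⟨⟨0, hpos⟩⟩
  have hcard : #{x : TargetSet K Ω × Fin δ | T.1 ⊆ x.1.1} = numSub K t Ω δ := by
    rw [← Finset.univ_product_univ, Finset.filter_product_left (fun A : TargetSet K Ω ↦ T.1 ⊆ A.1),
      Finset.card_product, card_targetSet_superset h, Finset.card_fin, numSub, mul_comm]
  refine (Set.toFinite _).exists_bijOn_of_encard_eq ?_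
  rw [← Finset.coe_filter_univ, Set.encard_coe_eq_coe_finsetCard, hcard, Set.encard_univ,
    ENat.card_eq_coe_fintype_card, Fintype.card_fin]

theorem nonempty_deliveryPlan {K t Ω δ : ℕ} (h : t + 1 ≤ Ω) (hK : Ω ≤ K) (hδ : 0 < δ) :
    Nonempty (DeliveryPlan K t Ω δ) := by
  have hpos : 0 < numSub K t Ω δ := Nat.mul_pos hδ (Nat.choose_pos (by omega))
  choose label hlabel using exists_label_bijOn hpos h
  exact ⟨⟨fun A ↦ (nonempty_baseSchedule A).some, fun T A d ↦ label T (A, d), hlabel⟩⟩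

end Schedule

section Delivery

theorem card_fin_div_eq {n η r : ℕ} (hη : 0 < η) (hr : r < n / η) :
    #{z : Fin n | z / η = r} = η := by
  have hrn : (r + 1) * η ≤ n := (Nat.mul_le_mul_right η hr).trans (Nat.div_mul_le_self _ _)
  rw [Nat.succ_mul] at hrn
  calc #{z : Fin n | z / η = r} = #(Finset.Ico (r * η) (r * η + η)) := by
        rw [← Finset.card_map Fin.valEmbedding]
        congr 1
        ext z
        simp only [Finset.mem_map, Finset.mem_filter, Finset.mem_univ, true_and,
          Fin.valEmbedding_apply, Finset.mem_Ico, Nat.div_eq_iff hη]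
        exact ⟨by rintro ⟨z, hz, rfl⟩; omega, fun hz ↦ ⟨⟨z, by omega⟩, by simp only; omega, rfl⟩⟩
    _ = η := by simp

theorem card_le_of_forall_lt_add {D : Finset ℕ} {X : ℕ}
    (hD : ∀ d ∈ D, ∀ d' ∈ D, d' < d + X) : #D ≤ X := by
  rcases D.eq_empty_or_nonempty with rfl | hne
  · simp
  calc #D ≤ #(Finset.Ico (D.min' hne) (D.min' hne + X)) :=
        Finset.card_le_card fun d hd ↦
          Finset.mem_Ico.2 ⟨D.min'_le d hd, hD _ (D.min'_mem hne) d hd⟩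
    _ = X := by simp

namespace DeliveryPlan

variable {K t Ω δ η : ℕ} (p : DeliveryPlan K t Ω δ) {A : TargetSet K Ω}
  {r : Fin (δ * S0 t Ω / η)} {x : Fin δ × CodewordIdx K t}

theorem mem_block : x ∈ p.block η A r ↔
    ∃ s : Fin (S0 t Ω), x.2 ∈ (p.base A).column s ∧ (S0 t Ω * x.1 + s) / η = r := by
  simp only [block, Finset.mem_biUnion, Finset.mem_filter, Finset.mem_univ, true_and,
    Finset.mem_image, Prod.exists]
  constructor
  · rintro ⟨d, s, hr, T, hT, rfl⟩
    exact ⟨s, hT, hr⟩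
  · rintro ⟨s, hT, hr⟩
    exact ⟨x.1, s, hr, x.2, hT, rfl⟩

theorem subset_of_mem_block (hx : x ∈ p.block η A r) : x.2.1 ⊆ A.1 := by
  obtain ⟨s, hs, -⟩ := p.mem_block.1 hx
  exact (p.base A).subset_target s _ hs

theorem column_unique {s s' : Fin (S0 t Ω)} {T : CodewordIdx K t}
    (hT : T ∈ (p.base A).column s) (hT' : T ∈ (p.base A).column s') : s = s' :=
  ((p.base A).partition T ((p.base A).subset_target s T hT)).unique hT hT'

theorem block_unique {r' : Fin (δ * S0 t Ω / η)} (hx : x ∈ p.block η A r)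
    (hx' : x ∈ p.block η A r') : r = r' := by
  obtain ⟨s, hs, hr⟩ := p.mem_block.1 hx
  obtain ⟨s', hs', hr'⟩ := p.mem_block.1 hx'
  obtain rfl := p.column_unique hs hs'
  exact Fin.ext (hr ▸ hr')

theorem exists_mem_block (hdvd : η ∣ δ * S0 t Ω) (hx : x.2.1 ⊆ A.1) : ∃ r, x ∈ p.block η A r := by
  obtain ⟨s, hs, -⟩ := (p.base A).partition x.2 hx
  have hlt : S0 t Ω * x.1 + s < δ * S0 t Ω := by
    calc S0 t Ω * x.1 + s < S0 t Ω * x.1 + S0 t Ω := by lia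
      _ = (x.1 + 1) * S0 t Ω := by ring
      _ ≤ δ * S0 t Ω := Nat.mul_le_mul_right _ x.1.2
  exact ⟨⟨_, Nat.div_lt_div_of_lt_of_dvd hdvd hlt⟩, p.mem_block.2 ⟨s, hs, rfl⟩⟩

theorem card_columns_block (hη : 0 < η) (r : Fin (δ * S0 t Ω / η)) :
    #{c : Fin δ × Fin (S0 t Ω) | (S0 t Ω * c.1 + c.2) / η = r} = η :=
  (Finset.card_equiv finProdFinEquiv fun c ↦ by
    simp [finProdFinEquiv_apply_val, add_comm]).trans (card_fin_div_eq hη r.2)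

theorem card_filter_mem_block (hη : 0 < η) (r : Fin (δ * S0 t Ω / η)) {k : Fin K}
    (hk : k ∈ A.1) : #{x ∈ p.block η A r | k ∈ x.2.1} = η * beta0 t Ω := by
  classical
  rw [block, Finset.filter_biUnion, Finset.card_biUnion]
  · simp only [Finset.filter_image, Finset.card_image_of_injective _ (Prod.mk_right_injective _),
      (p.base A).regular _ k hk, Finset.sum_const, card_columns_block hη, smul_eq_mul]
  · rintro ⟨d, s⟩ - ⟨d', s'⟩ - hne
    refine Finset.disjoint_left.2 ?_
    simp only [Finset.mem_filter, Finset.mem_image, not_and, and_imp, forall_exists_index]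
    rintro _ T hT rfl - T' hT' h
    obtain ⟨rfl, rfl⟩ := Prod.mk.inj h
    exact fun _ ↦ hne (Prod.ext rfl (p.column_unique hT hT'))

theorem card_filter_eq_block_le (hη : 0 < η) {X : ℕ} (hX : η ≤ X * S0 t Ω)
    (T : CodewordIdx K t) : #{y ∈ p.block η A r | y.2 = T} ≤ X := by
  classical
  have hinj : Set.InjOn (fun y : Fin δ × CodewordIdx K t ↦ (y.1 : ℕ))
      (Finset.filter (fun y ↦ y.2 = T) (p.block η A r) : Set _) := by
    intro y hy y' hy' h
    exact Prod.ext (Fin.ext h)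
      ((Finset.mem_filter.1 hy).2.trans (Finset.mem_filter.1 hy').2.symm)
  rw [← Finset.card_image_of_injOn hinj]
  refine card_le_of_forall_lt_add fun d hd d' hd' ↦ ?_
  simp only [Finset.mem_image, Finset.mem_filter, mem_block] at hd hd'
  obtain ⟨⟨d, _⟩, ⟨⟨s, hs, hr⟩, rfl⟩, rfl⟩ := hd
  obtain ⟨⟨d', T⟩, ⟨⟨s', hs', hr'⟩, rfl⟩, rfl⟩ := hd'
  obtain rfl := p.column_unique hs hs'
  rw [Nat.div_eq_iff hη] at hr hr'
  by_contra! hle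
  have hmul : S0 t Ω * (d + X) ≤ S0 t Ω * d' := Nat.mul_le_mul_left _ hle
  rw [mul_add, mul_comm _ X] at hmul
  simp only at hr hr'
  omega

theorem subpacketOf_injective (k : Fin K) :
    Function.Injective (p.subpacketOf (η := η) (k := k)) := by
  rintro ⟨⟨A, r, d, T⟩, hx, hk⟩ ⟨⟨A', r', d', T'⟩, hx', hk'⟩ h
  simp only [subpacketOf, Prod.mk.injEq, CodewordIdx.packet, Subtype.mk.injEq] at h hk hk'
  obtain ⟨hpacket, hlabel⟩ := h
  obtain rfl : T = T' := Subtype.ext <| by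
    rw [← Finset.insert_erase hk, hpacket, Finset.insert_erase hk']
  obtain ⟨rfl, rfl⟩ := Prod.mk.inj <| (p.label_bijOn T).injOn (x₁ := (A, d)) (x₂ := (A', d'))
    (p.subset_of_mem_block hx) (p.subset_of_mem_block hx') hlabel
  obtain rfl := p.block_unique hx hx'
  rfl

theorem notMem_subpacketOf {k : Fin K} (y : p.Stream η k) : k ∉ (p.subpacketOf y).1.1 := by
  simp [subpacketOf, CodewordIdx.packet]

theorem exists_subpacketOf_eq (hdvd : η ∣ δ * S0 t Ω) {k : Fin K} {P : PacketIdx K t}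
    (hP : k ∉ P.1) (q : Fin (numSub K t Ω δ)) :
    ∃ y : p.Stream η k, p.subpacketOf y = (P, q) := by
  let T : CodewordIdx K t := ⟨insert k P.1, by rw [Finset.card_insert_of_notMem hP, P.2]⟩
  obtain ⟨⟨A, d⟩, hA, hq⟩ := (p.label_bijOn T).surjOn (Set.mem_univ q)
  obtain ⟨r, hr⟩ := p.exists_mem_block hdvd (x := (d, T)) hA
  refine ⟨⟨(A, r, d, T), hr, Finset.mem_insert_self _ _⟩, Prod.ext (Subtype.ext ?_) hq⟩
  exact Finset.erase_insert hP

/- All summands of the codeword except the desired one are cached. -/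
theorem exists_subpacket_decoder {N b : ℕ} (dem : Fin K → Fin N) {k : Fin K} (y : p.Stream η k) :
    ∃ dec : CacheData K N t (numSub K t Ω δ) b k → Bits b → Bits b,
      ∀ W : Fin N → FileData K t (numSub K t Ω δ) b,
        dec (cacheOf W k) (p.codewordOf W dem y) =
          W (dem k) (p.subpacketOf y).1 (p.subpacketOf y).2 := by
  obtain ⟨⟨A, r, d, T⟩, hx, hk⟩ := y
  have mem_packet (j : {j : {j // j ∈ T.1} // j ≠ ⟨k, hk⟩}) : k ∈ (T.packet j.1 j.1.2).1 :=
    Finset.mem_erase.2 ⟨fun h ↦ j.2 (Subtype.ext h.symm), hk⟩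
  refine ⟨fun c s ↦ s - ∑ j : {j : {j // j ∈ T.1} // j ≠ ⟨k, hk⟩},
    c (dem j.1) ⟨T.packet j.1 j.1.2, mem_packet j⟩ (p.label T A d), fun W ↦ ?_⟩
  simp only [codewordOf, codeword, subpacketOf, cacheOf]
  rw [Fintype.sum_eq_add_sum_subtype_ne _ (⟨k, hk⟩ : {j // j ∈ T.1}), add_sub_cancel_right]

theorem exists_file_decoder (hdvd : η ∣ δ * S0 t Ω) {N b : ℕ} (dem : Fin K → Fin N) (k : Fin K) :
    ∃ dec : CacheData K N t (numSub K t Ω δ) b k → (p.Stream η k → Bits b) →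
        FileData K t (numSub K t Ω δ) b,
      ∀ W : Fin N → FileData K t (numSub K t Ω δ) b,
        dec (cacheOf W k) (fun y ↦ p.codewordOf W dem y) = W (dem k) := by
  choose dec hdec using fun y : p.Stream η k ↦ p.exists_subpacket_decoder (b := b) dem y
  choose stream hstream using fun (P : PacketIdx K t) (hP : k ∉ P.1) ↦
    p.exists_subpacketOf_eq hdvd hP
  refine ⟨fun c s P q ↦ if hP : k ∈ P.1 then c (dem k) ⟨P, hP⟩ q
    else dec (stream P hP q) c (s (stream P hP q)), fun W ↦ ?_⟩
  funext P q
  by_cases hP : k ∈ P.1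
  · simp only [dif_pos hP, cacheOf]
  · simp only [dif_neg hP, hdec, hstream]

end DeliveryPlan

end Delivery

section LinewisePolynomial

/-- The measurable functions on a module over `R` that are polynomial along every line. Unlike
polynomial functions in coordinates, they need no basis and no finiteness. -/
def linewisePolynomial (R E : Type*) [CommRing R] [MeasurableSpace R] [MeasurableAdd₂ R]
    [MeasurableMul₂ R] [AddCommGroup E] [Module R E] [MeasurableSpace E] :
    Subalgebra R (E → R) where
  carrier := {f | Measurable f ∧ ∀ a b : E, ∃ P : Polynomial R, ∀ s : R, f (a + s • b) = P.eval s}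
  mul_mem' := by
    rintro f g ⟨hf, hf'⟩ ⟨hg, hg'⟩
    refine ⟨hf.mul hg, fun a b ↦ ?_⟩
    obtain ⟨P, hP⟩ := hf' a b
    obtain ⟨Q, hQ⟩ := hg' a b
    exact ⟨P * Q, fun s ↦ by simp [hP, hQ]⟩
  add_mem' := by
    rintro f g ⟨hf, hf'⟩ ⟨hg, hg'⟩
    refine ⟨hf.add hg, fun a b ↦ ?_⟩
    obtain ⟨P, hP⟩ := hf' a b
    obtain ⟨Q, hQ⟩ := hg' a b
    exact ⟨P + Q, fun s ↦ by simp [hP, hQ]⟩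
  algebraMap_mem' c := ⟨measurable_const, fun _ _ ↦ ⟨Polynomial.C c, fun _ ↦ by simp⟩⟩

namespace linewisePolynomial

variable {R E F : Type*} [CommRing R] [MeasurableSpace R] [MeasurableAdd₂ R] [MeasurableMul₂ R]
  [AddCommGroup E] [Module R E] [MeasurableSpace E] [AddCommGroup F] [Module R F]
  [MeasurableSpace F]

theorem linear_mem {φ : E → R} (hm : Measurable φ) (hφ : IsLinearMap R φ) :
    φ ∈ linewisePolynomial R E :=
  ⟨hm, fun a b ↦ ⟨Polynomial.C (φ a) + Polynomial.X * Polynomial.C (φ b), fun s ↦ by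
    simp [hφ.map_add, hφ.map_smul, mul_comm s]⟩⟩

theorem comp_affineMap_mem {f : E → R} (hf : f ∈ linewisePolynomial R E) (g : F →ᵃ[R] E)
    (hg : Measurable g) : f ∘ g ∈ linewisePolynomial R F := by
  refine ⟨hf.1.comp hg, fun a b ↦ ?_⟩
  obtain ⟨P, hP⟩ := hf.2 (g a) (g.linear b)
  refine ⟨P, fun s ↦ ?_⟩
  rw [← hP, ← map_smul, add_comm a, add_comm (g a)]
  exact congrArg f (g.map_vadd a (s • b))

theorem sum_mem {ι : Type*} {s : Finset ι} {f : ι → E → R}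
    (hf : ∀ i ∈ s, f i ∈ linewisePolynomial R E) :
    (fun x ↦ ∑ i ∈ s, f i x) ∈ linewisePolynomial R E := by
  simpa only [← Finset.sum_apply] using (linewisePolynomial R E).sum_mem hf

theorem prod_mem {ι : Type*} {s : Finset ι} {f : ι → E → R}
    (hf : ∀ i ∈ s, f i ∈ linewisePolynomial R E) :
    (fun x ↦ ∏ i ∈ s, f i x) ∈ linewisePolynomial R E := by
  simpa only [← Finset.prod_apply] using (linewisePolynomial R E).prod_mem hf

theorem measurableSet_ne_zero [MeasurableSingletonClass R] {f : E → R}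
    (hf : f ∈ linewisePolynomial R E) : MeasurableSet {x | f x ≠ 0} :=
  hf.1 (measurableSet_singleton 0).compl

section Matrix

variable {l m n : Type*}

theorem det_mem [Fintype m] [DecidableEq m] {M : E → Matrix m m R}
    (hM : ∀ i j, (fun x ↦ M x i j) ∈ linewisePolynomial R E) :
    (fun x ↦ (M x).det) ∈ linewisePolynomial R E := by
  simp only [det_apply']
  exact sum_mem fun σ _ ↦ (linewisePolynomial R E).mul_mem
    ((linewisePolynomial R E).algebraMap_mem _) (prod_mem fun i _ ↦ hM _ _)

theorem adjugate_mem [Fintype m] [DecidableEq m] {M : E → Matrix m m R}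
    (hM : ∀ i j, (fun x ↦ M x i j) ∈ linewisePolynomial R E) (i j : m) :
    (fun x ↦ (M x).adjugate i j) ∈ linewisePolynomial R E := by
  simp only [adjugate_apply]
  refine det_mem fun i' j' ↦ ?_
  by_cases h : i' = j
  · subst h
    simp only [updateRow_self]
    exact (linewisePolynomial R E).algebraMap_mem _
  · simpa [updateRow_ne h] using hM i' j'

theorem matrix_mul_mem [Fintype m] {M : E → Matrix l m R} {N : E → Matrix m n R}
    (hM : ∀ i j, (fun x ↦ M x i j) ∈ linewisePolynomial R E)
    (hN : ∀ i j, (fun x ↦ N x i j) ∈ linewisePolynomial R E) (i : l) (j : n) :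
    (fun x ↦ (M x * N x) i j) ∈ linewisePolynomial R E := by
  simp only [mul_apply]
  exact sum_mem fun k _ ↦ (linewisePolynomial R E).mul_mem (hM _ _) (hN _ _)

theorem mulVec_mem [Fintype n] {M : E → Matrix m n R} {v : E → n → R}
    (hM : ∀ i j, (fun x ↦ M x i j) ∈ linewisePolynomial R E)
    (hv : ∀ j, (fun x ↦ v x j) ∈ linewisePolynomial R E) (i : m) :
    (fun x ↦ (M x *ᵥ v x) i) ∈ linewisePolynomial R E := by
  simp only [mulVec, dotProduct]
  exact sum_mem fun k _ ↦ (linewisePolynomial R E).mul_mem (hM _ _) (hv _)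

end Matrix

variable [IsDomain R] [Infinite R]

/- Restrict to the line through a nonzero point of `f` and a nonzero point of `g`. -/
theorem exists_mul_ne_zero {f g : E → R} (hf : f ∈ linewisePolynomial R E)
    (hg : g ∈ linewisePolynomial R E) (hf₀ : ∃ a, f a ≠ 0) (hg₀ : ∃ a, g a ≠ 0) :
    ∃ a, f a * g a ≠ 0 := by
  obtain ⟨a, ha⟩ := hf₀
  obtain ⟨b, hb⟩ := hg₀
  obtain ⟨P, hP⟩ := hf.2 a (b - a)
  obtain ⟨Q, hQ⟩ := hg.2 a (b - a)
  by_contra! hcon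
  have hPQ : P * Q = 0 := Polynomial.funext fun s ↦ by
    rw [Polynomial.eval_mul, ← hP, ← hQ, hcon, Polynomial.eval_zero]
  rcases mul_eq_zero.1 hPQ with rfl | rfl
  · exact ha (by simpa using hP 0)
  · exact hb (by simpa using hQ 1)

theorem exists_forall_ne_zero {ι : Type*} (s : Finset ι) {f : ι → E → R}
    (hf : ∀ i ∈ s, f i ∈ linewisePolynomial R E) (hf₀ : ∀ i ∈ s, ∃ a, f i a ≠ 0) :
    ∃ a, ∀ i ∈ s, f i a ≠ 0 := by
  classical
  simp only [← Finset.prod_ne_zero_iff]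
  induction s using Finset.induction_on with
  | empty => exact ⟨0, by simp⟩
  | insert i s hi ih =>
    simp only [Finset.prod_insert hi]
    rw [Finset.forall_mem_insert] at hf hf₀
    exact exists_mul_ne_zero hf.1 (prod_mem hf.2) hf₀.1 (ih hf.2 hf₀.2)

end linewisePolynomial

/-- A measure under which every nonzero linewise polynomial is almost everywhere nonzero; this is
the sense in which a random point is in general position. -/
def AvoidsPolynomialZeros (R : Type*) {E : Type*} [CommRing R] [MeasurableSpace R]
    [MeasurableAdd₂ R] [MeasurableMul₂ R] [AddCommGroup E] [Module R E] [MeasurableSpace E]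
    (μ : Measure E) : Prop :=
  ∀ f ∈ linewisePolynomial R E, (∃ a, f a ≠ 0) → ∀ᵐ x ∂μ, f x ≠ 0

namespace AvoidsPolynomialZeros

variable {R E F : Type*} [CommRing R] [MeasurableSpace R] [MeasurableAdd₂ R] [MeasurableMul₂ R]
  [AddCommGroup E] [Module R E] [MeasurableSpace E] [AddCommGroup F] [Module R F]
  [MeasurableSpace F]

theorem of_nullSingletonClass [IsDomain R] (μ : Measure R) [NullSingletonClass μ] :
    AvoidsPolynomialZeros R μ := by
  rintro f ⟨-, hf⟩ ⟨a, ha⟩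
  obtain ⟨P, hP⟩ := hf 0 1
  have hfP (s : R) : f s = P.eval s := by simpa using hP s
  have hP₀ : P ≠ 0 := by
    rintro rfl
    exact ha (by simp [hfP])
  have hfin : {s | f s = 0}.Finite := by
    simpa only [hfP, Polynomial.IsRoot.def] using Polynomial.finite_setOfPred_isRoot hP₀
  simpa [ae_iff] using hfin.measure_zero μ

theorem map [MeasurableSingletonClass R] {μ : Measure E} (hμ : AvoidsPolynomialZeros R μ)
    (g : E →ᵃ[R] F) (hg : Measurable g) (hsurj : Function.Surjective g) :
    AvoidsPolynomialZeros R (μ.map g) := by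
  rintro f hf ⟨b, hb⟩
  obtain ⟨a, rfl⟩ := hsurj b
  rw [ae_map_iff hg.aemeasurable (linewisePolynomial.measurableSet_ne_zero hf)]
  exact hμ _ (linewisePolynomial.comp_affineMap_mem hf g hg) ⟨a, hb⟩

theorem prod [MeasurableSingletonClass R] {μ : Measure E} {ν : Measure F} [SFinite ν]
    (hμ : AvoidsPolynomialZeros R μ) (hν : AvoidsPolynomialZeros R ν) :
    AvoidsPolynomialZeros R (μ.prod ν) := by
  rintro f hf ⟨⟨a, b⟩, hab⟩
  rw [Measure.ae_prod_iff_ae_ae (linewisePolynomial.measurableSet_ne_zero hf)]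
  filter_upwards [hμ _ (linewisePolynomial.comp_affineMap_mem hf
    ((AffineMap.id R E).prod (AffineMap.const R E b)) measurable_prodMk_right) ⟨a, hab⟩] with x hx
  exact hν _ (linewisePolynomial.comp_affineMap_mem hf
    ((AffineMap.const R F x).prod (AffineMap.id R F)) measurable_prodMk_left) ⟨b, hx⟩

theorem pi [MeasurableSingletonClass R] {n : ℕ} {E : Fin n → Type*} [∀ i, AddCommGroup (E i)]
    [∀ i, Module R (E i)] [∀ i, MeasurableSpace (E i)] {μ : ∀ i, Measure (E i)}
    [∀ i, SigmaFinite (μ i)] (hμ : ∀ i, AvoidsPolynomialZeros R (μ i)) :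
    AvoidsPolynomialZeros R (Measure.pi μ) := by
  induction n with
  | zero =>
    rintro f - ⟨a, ha⟩
    exact .of_forall fun x ↦ Subsingleton.elim a x ▸ ha
  | succ n ih =>
    let e := MeasurableEquiv.piFinSuccAbove E 0
    let g := (Fin.consLinearEquiv R E).toLinearMap.toAffineMap
    have hg : ⇑g = e.symm := funext fun x ↦ (Fin.insertNth_zero x.1 x.2).symm
    rw [← ((measurePreserving_piFinSuccAbove μ 0).symm e).map_eq, ← hg]
    exact ((hμ 0).prod (ih fun i ↦ hμ i.succ)).map g (hg ▸ e.symm.measurable)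
      (hg ▸ e.symm.surjective)

end AvoidsPolynomialZeros

instance nullSingletonClass_complexGaussian : NullSingletonClass complexGaussian := by
  have : NullSingletonClass (gaussianReal 0 (1 / 2)) := nullSingletonClass_gaussianReal (by simp)
  refine ⟨fun z ↦ ?_⟩
  rw [complexGaussian, Measure.map_apply (by fun_prop) (measurableSet_singleton z)]
  refine measure_mono_null (t := {z.re} ×ˢ {z.im}) ?_
    (by rw [Measure.prod_prod, measure_singleton, zero_mul])
  rintro x rfl
  simp

instance isProbabilityMeasure_complexGaussian : IsProbabilityMeasure complexGaussian :=
  Measure.isProbabilityMeasure_map (by fun_prop)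

theorem avoidsPolynomialZeros_channelLaw (K G L : ℕ) :
    AvoidsPolynomialZeros ℂ (channelLaw K G L) :=
  .pi fun _ ↦ .pi fun _ ↦ .pi fun _ ↦ .of_nullSingletonClass complexGaussian

end LinewisePolynomial

section KernelVec

variable {R m n : Type*} [CommRing R] [Fintype m] [DecidableEq m] [Fintype n]

/-- The vector `det (M N) v - N adj(M N) M v` of the kernel of `M`. When `M N` is invertible it is
a multiple of the projection of `v` to the kernel along the range of `N`; multiplying by the
determinant makes it polynomial in `M`, `N` and `v`. -/
noncomputable def kernelVec (M : Matrix m n R) (N : Matrix n m R) (v : n → R) : n → R :=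
  (M * N).det • v - N *ᵥ ((M * N).adjugate *ᵥ (M *ᵥ v))

theorem mulVec_kernelVec (M : Matrix m n R) (N : Matrix n m R) (v : n → R) :
    M *ᵥ kernelVec M N v = 0 := by
  rw [kernelVec, mulVec_sub, mulVec_smul, mulVec_mulVec, mulVec_mulVec, mul_adjugate, smul_mulVec,
    one_mulVec, sub_self]

theorem kernelVec_of_mulVec_eq_zero {M : Matrix m n R} (N : Matrix n m R) {v : n → R}
    (h : M *ᵥ v = 0) : kernelVec M N v = (M * N).det • v := by
  simp [kernelVec, h]

end KernelVec

section Coordinates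

variable {κ n τ : Type*} [DecidableEq κ] [Fintype n]

/-- The pairs of a user outside `S` and a receive antenna: the places at which a codeword for the
users in `S` has to be nulled. -/
abbrev NulledAntennas (S : Finset κ) (n : Type*) : Type _ := {j // j ∉ S} × n

theorem card_le_card_image_mul {S : Finset κ} (X : Finset (NulledAntennas S n)) :
    #X ≤ #(X.image fun q ↦ q.1.1) * Fintype.card n := by
  classical
  calc #X ≤ #((X.image fun q ↦ q.1.1) ×ˢ (Finset.univ : Finset n)) :=
        Finset.card_le_card_of_injOn (fun q ↦ (q.1.1, q.2))
          (fun q hq ↦ Finset.mem_coe.2 (Finset.mem_product.2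
            ⟨Finset.mem_image_of_mem _ hq, Finset.mem_univ _⟩))
          fun q _ q' _ h ↦ Prod.ext (Subtype.ext (Prod.mk.inj h).1) (Prod.mk.inj h).2
    _ = _ := by rw [Finset.card_product, Finset.card_univ]

variable [Fintype κ] {S : n → Finset κ} {a : ℕ}

theorem card_mul_add_card_disjoint_le {L : ℕ} {c₀ : n} (hcard : ∀ c, #(S c)ᶜ = a)
    (hL : a * Fintype.card n + #{c | S c = S c₀} ≤ L) {J : Finset κ} (hJ : J ⊆ (S c₀)ᶜ) :
    #J * Fintype.card n + #{c | Disjoint (S c) J} ≤ L := by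
  have hJa : #J ≤ a := hcard c₀ ▸ Finset.card_le_card hJ
  rcases hJa.eq_or_lt with hJa | hJa
  · have hJ' : J = (S c₀)ᶜ := Finset.eq_of_subset_of_card_le hJ (by rw [hcard, hJa])
    have hS {c : n} (hc : Disjoint (S c) J) : S c = S c₀ := by
      rw [hJ', disjoint_compl_right_iff] at hc
      have hcompl : (S c₀)ᶜ = (S c)ᶜ :=
        Finset.eq_of_subset_of_card_le (Finset.compl_subset_compl.2 hc) (by rw [hcard, hcard])
      exact compl_injective hcompl.symm
    calc #J * Fintype.card n + #{c | Disjoint (S c) J}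
        ≤ a * Fintype.card n + #{c | S c = S c₀} := by
          rw [hJa]
          gcongr with c
          exact hS
      _ ≤ L := hL
  · calc #J * Fintype.card n + #{c | Disjoint (S c) J}
        ≤ #J * Fintype.card n + Fintype.card n := by gcongr; exact Finset.card_le_univ _
      _ = (#J + 1) * Fintype.card n := (Nat.succ_mul _ _).symm
      _ ≤ a * Fintype.card n := Nat.mul_le_mul_right _ hJa
      _ ≤ L := by lia

/- Hall's theorem: a set of nulled antennas of the users in `J` is denied only those coordinates
`σ c` for which no user in `J` wants the codeword `c`. -/
theorem exists_injective_nulledAntennas [Fintype τ] (σ : n ↪ τ) {c₀ : n}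
    (hcard : ∀ c, #(S c)ᶜ = a)
    (hL : a * Fintype.card n + #{c | S c = S c₀} ≤ Fintype.card τ) :
    ∃ s : NulledAntennas (S c₀) n → τ, Function.Injective s ∧
      ∀ q c, σ c = s q → q.1.1 ∈ S c := by
  classical
  let allowed (q : NulledAntennas (S c₀) n) : Finset τ := {l | ∀ c, σ c = l → q.1.1 ∈ S c}
  suffices hall : ∀ X, #X ≤ #(X.biUnion allowed) by
    obtain ⟨s, hs, hmem⟩ := (Finset.all_card_le_biUnion_card_iff_exists_injective allowed).1 hall
    exact ⟨s, hs, fun q ↦ by simpa [allowed] using hmem q⟩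
  intro X
  rcases X.eq_empty_or_nonempty with rfl | ⟨q₀, hq₀⟩
  · simp
  let J : Finset κ := X.image fun q ↦ q.1.1
  have hJ : J ⊆ (S c₀)ᶜ := by
    intro j hj
    obtain ⟨q, -, rfl⟩ := Finset.mem_image.1 hj
    exact Finset.mem_compl.2 q.1.2
  have hdenied : (X.biUnion allowed)ᶜ ⊆ Finset.map σ {c | Disjoint (S c) J} := by
    intro l hl
    have hdeny : ∀ q ∈ X, ∃ c, σ c = l ∧ q.1.1 ∉ S c := by simpa [allowed] using hl
    obtain ⟨c, rfl, -⟩ := hdeny q₀ hq₀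
    simp only [EmbeddingLike.apply_eq_iff_eq, exists_eq_left] at hdeny
    simpa [J, Finset.disjoint_right] using hdeny
  have hle := Finset.card_le_card hdenied
  rw [Finset.card_map, Finset.card_compl] at hle
  have hX := card_le_card_image_mul X
  have hcount := card_mul_add_card_disjoint_le hcard hL hJ
  lia

end Coordinates

section ZeroForcing

variable {ι κ n τ : Type*} [Fintype κ] [DecidableEq κ] [Fintype n] [DecidableEq n] [Fintype τ]

/-- The channel to the antennas at which a codeword for the users in `S` has to be nulled. -/
def interferenceMatrix (S : Finset κ) (H : κ → n → τ → ℂ) : Matrix (NulledAntennas S n) τ ℂ :=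
  of fun q ↦ H q.1 q.2

/-- The channels, together with the two parameters of the zero-forcing beamformers: a second array
of the shape of the channels, which spans a complement of the kernel of each interference matrix,
and one vector for every codeword, which is projected to that kernel. -/
abbrev ZeroForcingParams (ι κ n τ : Type*) : Type _ :=
  (κ → n → τ → ℂ) × (κ → n → τ → ℂ) × (ι → τ → ℂ)

/-- The beamformer of the codeword `x`, which is nulled at all antennas of the users outside
`S x`. -/
noncomputable def zeroForcing (S : ι → Finset κ) (z : ZeroForcingParams ι κ n τ) (x : ι) : τ → ℂ :=
  kernelVec (interferenceMatrix (S x) z.1) (interferenceMatrix (S x) z.2.1)ᵀ (z.2.2 x)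

theorem mulVec_zeroForcing {S : ι → Finset κ} (z : ZeroForcingParams ι κ n τ) {x : ι} {k : κ}
    (hk : k ∉ S x) : of (z.1 k) *ᵥ zeroForcing S z x = 0 :=
  funext fun r ↦ congrFun (mulVec_kernelVec (interferenceMatrix (S x) z.1) _ _) (⟨k, hk⟩, r)

theorem zeroForcing_mem (S : ι → Finset κ) (x : ι) (l : τ) :
    (fun z ↦ zeroForcing S z x l) ∈ linewisePolynomial ℂ (ZeroForcingParams ι κ n τ) := by
  have hM (i j) : (fun z : ZeroForcingParams ι κ n τ ↦ interferenceMatrix (S x) z.1 i j) ∈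
      linewisePolynomial ℂ _ :=
    linewisePolynomial.linear_mem (by simp only [interferenceMatrix, of_apply]; fun_prop)
      ⟨fun _ _ ↦ rfl, fun _ _ ↦ rfl⟩
  have hN (i j) : (fun z : ZeroForcingParams ι κ n τ ↦ (interferenceMatrix (S x) z.2.1)ᵀ i j) ∈
      linewisePolynomial ℂ _ :=
    linewisePolynomial.linear_mem (by
      simp only [interferenceMatrix, transpose_apply, of_apply]; fun_prop)
      ⟨fun _ _ ↦ rfl, fun _ _ ↦ rfl⟩
  have hv (j) : (fun z : ZeroForcingParams ι κ n τ ↦ z.2.2 x j) ∈ linewisePolynomial ℂ _ :=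
    linewisePolynomial.linear_mem (by fun_prop) ⟨fun _ _ ↦ rfl, fun _ _ ↦ rfl⟩
  have hMN := linewisePolynomial.matrix_mul_mem hM hN
  exact (linewisePolynomial ℂ _).sub_mem
    ((linewisePolynomial ℂ _).mul_mem (linewisePolynomial.det_mem hMN) (hv l))
    (linewisePolynomial.mulVec_mem hN (linewisePolynomial.mulVec_mem
      (linewisePolynomial.adjugate_mem hMN) (linewisePolynomial.mulVec_mem hM hv)) l)

/-- The channels for which the coordinate vector at `σ c` is nulled at all users who do not want
the codeword `c`. -/
def coordinateNulling (S : n → Finset κ) (σ : n ↪ τ) : Submodule ℂ (κ → n → τ → ℂ) where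
  carrier := {H | ∀ c, ∀ j ∉ S c, ∀ r, H j r (σ c) = 0}
  add_mem' hH hH' c j hj r := by simp [hH c j hj r, hH' c j hj r]
  zero_mem' _ _ _ _ := rfl
  smul_mem' s H hH c j hj r := by simp [hH c j hj r]

theorem exists_interferenceMatrix_mul_transpose_eq_one {S : n → Finset κ} {a : ℕ} (σ : n ↪ τ)
    {c₀ : n} (hcard : ∀ c, #(S c)ᶜ = a)
    (hL : a * Fintype.card n + #{c | S c = S c₀} ≤ Fintype.card τ) :
    ∃ H ∈ coordinateNulling S σ,
      interferenceMatrix (S c₀) H * (interferenceMatrix (S c₀) H)ᵀ = 1 := by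
  classical
  obtain ⟨s, hs, hsS⟩ := exists_injective_nulledAntennas σ hcard hL
  let H : κ → n → τ → ℂ := fun j r ↦ if hj : j ∉ S c₀ then Pi.single (s (⟨j, hj⟩, r)) 1 else 0
  refine ⟨H, fun c j hj r ↦ ?_, ?_⟩
  · by_cases hj₀ : j ∈ S c₀
    · simp [H, hj₀]
    · have hne : σ c ≠ s (⟨j, hj₀⟩, r) := fun h ↦ hj (hsS _ c h)
      simp [H, hj₀, hne]
  · have hH (q : NulledAntennas (S c₀) n) : interferenceMatrix (S c₀) H q = Pi.single (s q) 1 :=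
      dif_pos q.1.2
    ext q q'
    change interferenceMatrix (S c₀) H q ⬝ᵥ interferenceMatrix (S c₀) H q' = _
    rw [hH, hH]
    simp [one_apply, Pi.single_apply, hs.eq_iff, eq_comm (a := q)]

theorem exists_det_interferenceMatrix_ne_zero {S : n → Finset κ} {a : ℕ} (σ : n ↪ τ)
    (hcard : ∀ c, #(S c)ᶜ = a)
    (hL : ∀ c₀, a * Fintype.card n + #{c | S c = S c₀} ≤ Fintype.card τ) :
    ∃ H ∈ coordinateNulling S σ, ∃ V : κ → n → τ → ℂ, ∀ c,
      (interferenceMatrix (S c) H * (interferenceMatrix (S c) V)ᵀ).det ≠ 0 := by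
  let E := coordinateNulling S σ × (κ → n → τ → ℂ)
  let d (c : n) (H V : κ → n → τ → ℂ) : ℂ :=
    (interferenceMatrix (S c) H * (interferenceMatrix (S c) V)ᵀ).det
  have hH : Measurable fun z : E ↦ (z.1 : κ → n → τ → ℂ) :=
    measurable_subtype_coe.comp measurable_fst
  have hV : Measurable fun z : E ↦ z.2 := measurable_snd
  have hmem (c : n) : (fun z : E ↦ d c z.1 z.2) ∈ linewisePolynomial ℂ E :=
    linewisePolynomial.det_mem <| linewisePolynomial.matrix_mul_mem
      (fun _ _ ↦ linewisePolynomial.linear_mem hH.eval.eval.eval ⟨fun _ _ ↦ rfl, fun _ _ ↦ rfl⟩)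
      fun _ _ ↦ linewisePolynomial.linear_mem hV.eval.eval.eval ⟨fun _ _ ↦ rfl, fun _ _ ↦ rfl⟩
  obtain ⟨⟨⟨H, hH⟩, V⟩, hdet⟩ := linewisePolynomial.exists_forall_ne_zero Finset.univ
    (fun c _ ↦ hmem c) fun c _ ↦ by
      obtain ⟨H, hH, hone⟩ := exists_interferenceMatrix_mul_transpose_eq_one σ hcard (hL c)
      exact ⟨(⟨H, hH⟩, H), by simp [d, hone]⟩
  exact ⟨H, hH, V, fun c ↦ hdet c (Finset.mem_univ c)⟩

/-- The gains with which user `k` receives the streams of the codewords `e c` at its antennas. -/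
noncomputable def effectiveChannel (S : ι → Finset κ) (k : κ) (e : n → ι)
    (z : ZeroForcingParams ι κ n τ) : Matrix n n ℂ :=
  of fun r c ↦ z.1 k r ⬝ᵥ zeroForcing S z (e c)

theorem det_effectiveChannel_mem (S : ι → Finset κ) (k : κ) (e : n → ι) :
    (fun z ↦ (effectiveChannel S k e z).det) ∈
      linewisePolynomial ℂ (ZeroForcingParams ι κ n τ) :=
  linewisePolynomial.det_mem fun r c ↦
    linewisePolynomial.mulVec_mem (M := fun z : ZeroForcingParams ι κ n τ ↦ of (z.1 k))
      (fun _ _ ↦ linewisePolynomial.linear_mem (by simp only [of_apply]; fun_prop)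
        ⟨fun _ _ ↦ rfl, fun _ _ ↦ rfl⟩)
      (fun l ↦ zeroForcing_mem S (e c) l) r

/- User `k` gets the channel with the rows `σ r`. It is not nulled for any of the codewords, so the
interference matrices stay the same, and the gains of the beamformers form a diagonal matrix. -/
theorem exists_det_effectiveChannel_id_ne_zero {S : n → Finset κ} {a : ℕ} {k : κ}
    (hk : ∀ c, k ∈ S c) (hcard : ∀ c, #(S c)ᶜ = a)
    (hL : ∀ c₀, a * Fintype.card n + #{c | S c = S c₀} ≤ Fintype.card τ) :
    ∃ z : ZeroForcingParams n κ n τ, (effectiveChannel S k id z).det ≠ 0 := by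
  classical
  rcases isEmpty_or_nonempty n with hn | ⟨⟨c₀⟩⟩
  · exact ⟨0, by simp⟩
  have hle : Fintype.card n ≤ Fintype.card τ := by
    simpa using card_mul_add_card_disjoint_le hcard (hL c₀) (Finset.empty_subset _)
  obtain ⟨σ⟩ := Function.Embedding.nonempty_of_card_le hle
  obtain ⟨H, hH, V, hdet⟩ := exists_det_interferenceMatrix_ne_zero σ hcard hL
  let H₀ := Function.update H k fun r ↦ Pi.single (σ r) 1
  let z : ZeroForcingParams n κ n τ := (H₀, V, fun c ↦ Pi.single (σ c) 1)
  let d (c : n) := (interferenceMatrix (S c) H * (interferenceMatrix (S c) V)ᵀ).det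
  have hinterference (c : n) : interferenceMatrix (S c) H₀ = interferenceMatrix (S c) H := by
    ext q l
    have hqk : q.1.1 ≠ k := fun h ↦ q.1.2 (h ▸ hk c)
    simp [interferenceMatrix, H₀, hqk]
  have hbeam (c : n) : zeroForcing S z c = d c • Pi.single (σ c) 1 := by
    have hker : interferenceMatrix (S c) H *ᵥ Pi.single (σ c) 1 = 0 := by
      ext q
      simpa [interferenceMatrix] using hH c q.1 q.1.2 q.2
    simp only [zeroForcing, z, hinterference, kernelVec_of_mulVec_eq_zero _ hker, d]
  have hdiag : effectiveChannel S k id z = diagonal d := by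
    ext r c
    change z.1 k r ⬝ᵥ zeroForcing S z c = _
    rcases eq_or_ne r c with rfl | hrc
    · simp [hbeam, z, H₀]
    · simp [hbeam, z, H₀, hrc]
  refine ⟨z, ?_⟩
  rw [hdiag, det_diagonal]
  exact Finset.prod_ne_zero_iff.2 fun c _ ↦ hdet c

theorem exists_det_effectiveChannel_ne_zero {S : ι → Finset κ} {C : Finset ι} {a : ℕ} {k : κ}
    (e : n ≃ {x // x ∈ C ∧ k ∈ S x}) (hcard : ∀ x ∈ C, #(S x)ᶜ = a)
    (hL : ∀ x ∈ C, a * Fintype.card n + #{y ∈ C | S y = S x} ≤ Fintype.card τ) :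
    ∃ z : ZeroForcingParams ι κ n τ, (effectiveChannel S k (fun c ↦ (e c).1) z).det ≠ 0 := by
  have hinj : Function.Injective fun c ↦ (e c).1 := Subtype.val_injective.comp e.injective
  have hcount (c₀ : n) : #{c | S (e c) = S (e c₀)} ≤ #{y ∈ C | S y = S (e c₀)} :=
    Finset.card_le_card_of_injOn (fun c ↦ (e c).1)
      (fun c hc ↦ by simpa [(e c).2.1] using hc) hinj.injOn
  obtain ⟨⟨H, V, v⟩, hdet⟩ := exists_det_effectiveChannel_id_ne_zero (τ := τ)
    (S := fun c ↦ S (e c)) (fun c ↦ (e c).2.2) (fun c ↦ hcard _ (e c).2.1)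
    fun c₀ ↦ (Nat.add_le_add_left (hcount c₀) _).trans (hL _ (e c₀).2.1)
  refine ⟨(H, V, Function.extend (fun c ↦ (e c).1) v 0), ?_⟩
  simpa only [effectiveChannel, zeroForcing, hinj.extend_apply, id] using hdet

theorem AvoidsPolynomialZeros.exists_ae_det_effectiveChannel_ne_zero
    {μ : Measure (κ → n → τ → ℂ)} (hμ : AvoidsPolynomialZeros ℂ μ) {S : ι → Finset κ}
    {C : Finset ι} {a : ℕ} (e : ∀ k, n ≃ {x // x ∈ C ∧ k ∈ S x}) (hcard : ∀ x ∈ C, #(S x)ᶜ = a)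
    (hL : ∀ x ∈ C, a * Fintype.card n + #{y ∈ C | S y = S x} ≤ Fintype.card τ) :
    ∃ V v, ∀ᵐ H ∂μ, ∀ k, (effectiveChannel S k (fun c ↦ (e k c).1) (H, V, v)).det ≠ 0 := by
  obtain ⟨⟨H₀, V, v⟩, hdet⟩ := linewisePolynomial.exists_forall_ne_zero Finset.univ
    (fun k _ ↦ det_effectiveChannel_mem (τ := τ) S k fun c ↦ (e k c).1)
    fun k _ ↦ exists_det_effectiveChannel_ne_zero (e k) hcard hL
  refine ⟨V, v, ae_all_iff.2 fun k ↦ ?_⟩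
  exact hμ _ (linewisePolynomial.comp_affineMap_mem
    (det_effectiveChannel_mem S k fun c ↦ (e k c).1)
    ((AffineMap.id ℂ _).prod (AffineMap.const ℂ _ (V, v))) measurable_prodMk_right)
    ⟨H₀, hdet k (Finset.mem_univ k)⟩

end ZeroForcing

section LinearReceivers

variable {ι : Type} {n : Type*} {K G L β m : ℕ}

theorem exists_star_dotProduct_eq_dotProduct_comp {r : Type*} [Fintype n] [Fintype r]
    (g : n → r) (c : n → ℂ) : ∃ u : r → ℂ, ∀ z, star u ⬝ᵥ z = c ⬝ᵥ (z ∘ g) := by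
  classical
  refine ⟨star (c ᵥ* (1 : Matrix r r ℂ).submatrix g id), fun z ↦ ?_⟩
  rw [star_star, ← dotProduct_mulVec]
  exact congrArg (c ⬝ᵥ ·) (funext fun i ↦ congrFun (one_mulVec z) (g i))

theorem decodesLinearly_of_dotProduct [DecidableEq ι] {H : Matrix (Fin G) (Fin L) ℂ}
    {C : Finset ι} {w : ι → Fin L → ℂ} {u : Fin G → ℂ} {x : ι} (hx : x ∈ C)
    (h : ∀ y ∈ C, star u ⬝ᵥ (H *ᵥ w y) = if y = x then 1 else 0) :
    DecodesLinearly H C w u x := by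
  intro sym z
  have hsum : ∑ y ∈ C, star u ⬝ᵥ (H *ᵥ sym y • w y) = ∑ y ∈ C, if y = x then sym y else 0 :=
    Finset.sum_congr rfl fun y hy ↦ by simp [mulVec_smul, h y hy]
  rw [dotProduct_add, mulVec_sum, dotProduct_sum, hsum, Finset.sum_ite_eq_of_mem' _ _ _ hx]

/- The receivers are the rows of the inverse of the effective channel. -/
theorem exists_forall_decodesLinearly [Fintype n] [DecidableEq n] {H : Matrix (Fin G) (Fin L) ℂ}
    {C : Finset ι} {w : ι → Fin L → ℂ} {p : ι → Prop} (g : n → Fin G) (e : n ≃ {x // x ∈ C ∧ p x})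
    (hdet : (of fun r c ↦ H (g r) ⬝ᵥ w (e c)).det ≠ 0)
    (hnull : ∀ x ∈ C, ¬p x → ∀ r, H (g r) ⬝ᵥ w x = 0) :
    ∃ u : ι → Fin G → ℂ, ∀ x ∈ C, p x → DecodesLinearly H C w (u x) x := by
  classical
  let D : Matrix n n ℂ := of fun r c ↦ H (g r) ⬝ᵥ w (e c)
  choose u hu using fun c ↦ exists_star_dotProduct_eq_dotProduct_comp g (D⁻¹ c)
  refine ⟨fun x ↦ if h : x ∈ C ∧ p x then u (e.symm ⟨x, h⟩) else 0, fun x hx hpx ↦ ?_⟩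
  simp only [dif_pos (And.intro hx hpx)]
  refine decodesLinearly_of_dotProduct hx fun y hy ↦ ?_
  obtain ⟨c, hc⟩ := e.surjective ⟨x, hx, hpx⟩
  rw [← hc, e.symm_apply_apply, hu]
  obtain rfl : (e c).1 = x := congrArg Subtype.val hc
  by_cases hpy : p y
  · obtain ⟨c', rfl⟩ : ∃ c', (e c').1 = y := ⟨e.symm ⟨y, hy, hpy⟩, by simp⟩
    calc D⁻¹ c ⬝ᵥ ((H *ᵥ w (e c')) ∘ g) = (D⁻¹ * D) c c' := rfl
      _ = if (e c').1 = (e c).1 then 1 else 0 := by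
        rw [nonsing_inv_mul D (isUnit_iff_ne_zero.2 hdet), one_apply]
        simp only [Subtype.val_inj, e.apply_eq_iff_eq, eq_comm]
  · have hne : y ≠ e c := fun h ↦ hpy (h ▸ hpx)
    have hzero : (H *ᵥ w y) ∘ g = 0 := funext (hnull y hy hpy)
    rw [hzero, dotProduct_zero, if_neg hne]

/-- The channels of the users in `A` to the first `β` receive antennas. -/
def restrictChannel (A : Finset (Fin K)) (hβ : β ≤ G) :
    (Fin K → Fin G → Fin L → ℂ) →ₗ[ℂ] ({k // k ∈ A} → Fin β → Fin L → ℂ) where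
  toFun H k r := H k (Fin.castLE hβ r)
  map_add' _ _ := rfl
  map_smul' _ _ := rfl

theorem measurable_restrictChannel (A : Finset (Fin K)) (hβ : β ≤ G) :
    Measurable (restrictChannel (L := L) A hβ) :=
  measurable_pi_lambda _ fun k ↦ measurable_pi_lambda _ fun r ↦
    (measurable_pi_apply (Fin.castLE hβ r)).comp (measurable_pi_apply k.1)

theorem restrictChannel_surjective (A : Finset (Fin K)) (hβ : β ≤ G) :
    Function.Surjective (restrictChannel (L := L) A hβ) := fun H ↦
  ⟨Function.extend Subtype.val (fun k ↦ Function.extend (Fin.castLE hβ) (H k) 0) 0, by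
    ext k r : 2
    simp [restrictChannel, (Fin.castLE_injective hβ).extend_apply]⟩

theorem card_compl_subtype_mem {α : Type*} [DecidableEq α] {A T : Finset α} (h : T ⊆ A) :
    #(T.subtype (· ∈ A))ᶜ = #A - #T := by
  rw [Finset.card_compl, Fintype.card_coe, Finset.card_subtype,
    Finset.filter_true_of_mem fun _ hx ↦ h hx]

theorem subtype_mem_inj {α : Type*} [DecidableEq α] {A T T' : Finset α} (h : T ⊆ A)
    (h' : T' ⊆ A) : T.subtype (· ∈ A) = T'.subtype (· ∈ A) ↔ T = T' := by
  refine ⟨fun hTT' ↦ ?_, congrArg _⟩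
  rw [← Finset.subtype_map_of_mem h, ← Finset.subtype_map_of_mem h', hTT']

theorem AvoidsPolynomialZeros.ae_exists_decodesLinearly
    {μ : Measure (Fin K → Fin G → Fin L → ℂ)} (hμ : AvoidsPolynomialZeros ℂ μ)
    {A : Finset (Fin K)} {C : Finset ι} {T : ι → Finset (Fin K)} (hβG : β ≤ G)
    (hβ : ∀ k ∈ A, #{x ∈ C | k ∈ T x} = β) (hTA : ∀ x ∈ C, T x ⊆ A) (hm : ∀ x ∈ C, #(T x) = m)
    (hL : ∀ x ∈ C, (#A - m) * β + #{y ∈ C | T y = T x} ≤ L) :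
    ∀ᵐ H ∂μ, ∃ w : ι → Fin L → ℂ, ∀ k ∈ A, ∃ u : ι → Fin G → ℂ, ∀ x ∈ C, k ∈ T x →
      DecodesLinearly (of (H k)) C w (u x) x := by
  let S (x : ι) : Finset {k // k ∈ A} := (T x).subtype (· ∈ A)
  have hcard : ∀ x ∈ C, #(S x)ᶜ = #A - m := fun x hx ↦
    hm x hx ▸ card_compl_subtype_mem (hTA x hx)
  have hLS : ∀ x ∈ C, (#A - m) * Fintype.card (Fin β) + #{y ∈ C | S y = S x} ≤
      Fintype.card (Fin L) := fun x hx ↦ by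
    have hfilter : {y ∈ C | S y = S x} = {y ∈ C | T y = T x} :=
      Finset.filter_congr fun y hy ↦ subtype_mem_inj (hTA y hy) (hTA x hx)
    simpa only [hfilter, Fintype.card_fin] using hL x hx
  let e (k : {k // k ∈ A}) : Fin β ≃ {x // x ∈ C ∧ k ∈ S x} :=
    (Finset.equivFinOfCardEq (hβ k k.2)).symm.trans (Equiv.subtypeEquivRight (by simp [S]))
  have hmeas := measurable_restrictChannel (L := L) A hβG
  obtain ⟨V, v, hdet⟩ := (hμ.map (restrictChannel A hβG).toAffineMap hmeas
    (restrictChannel_surjective A hβG)).exists_ae_det_effectiveChannel_ne_zero e hcard hLS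
  filter_upwards [ae_of_ae_map hmeas.aemeasurable hdet] with H hH
  let z : ZeroForcingParams ι {k // k ∈ A} (Fin β) (Fin L) := (restrictChannel A hβG H, V, v)
  refine ⟨zeroForcing S z, fun k hk ↦ ?_⟩
  obtain ⟨u, hu⟩ := exists_forall_decodesLinearly (H := of (H k)) (Fin.castLE hβG)
    (e ⟨k, hk⟩) (hH ⟨k, hk⟩) fun x _ hkx ↦ congrFun (mulVec_zeroForcing z hkx)
  exact ⟨u, fun x hx hkx ↦ hu x hx (Finset.mem_subtype.2 hkx)⟩

end LinearReceivers

section Parameters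

variable {L G t Ω η : ℕ}

theorem mul_beta0_le (h : (η : ℝ) ≤ G / beta0 t Ω) : η * beta0 t Ω ≤ G := by
  have hβ : (0 : ℝ) < beta0 t Ω := by exact_mod_cast beta0_pos t Ω
  rw [le_div_iff₀ hβ] at h
  exact_mod_cast h

theorem exists_le_mul_S0_add_le (htΩ : t + 1 ≤ Ω) (h : (η : ℝ) ≤
    (L : ℝ) * (S0 t Ω : ℝ) / (1 + ((Ω : ℝ) - (t : ℝ) - 1) * (S0 t Ω : ℝ) * (beta0 t Ω : ℝ))) :
    ∃ X, η ≤ X * S0 t Ω ∧ (Ω - (t + 1)) * (η * beta0 t Ω) + X ≤ L := by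
  obtain ⟨a, rfl⟩ := Nat.exists_eq_add_of_le htΩ
  rw [Nat.add_sub_cancel_left]
  set S := S0 t (t + 1 + a)
  set β := beta0 t (t + 1 + a)
  have hS : η + a * (η * β) * S ≤ L * S := by
    have ha : ((t + 1 + a : ℕ) : ℝ) - t - 1 = a := by push_cast; ring
    rw [ha, le_div_iff₀ (by positivity)] at h
    have hreal : (η : ℝ) + a * (η * β) * S ≤ L * S := by linarith
    exact_mod_cast hreal
  have haL : a * (η * β) ≤ L := by
    by_contra! hlt
    have hmul := Nat.mul_le_mul_right S hlt.le
    obtain rfl : η = 0 := by lia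
    simp at hlt
  obtain ⟨X, rfl⟩ := Nat.exists_eq_add_of_le haL
  exact ⟨X, by lia, le_rfl⟩

end Parameters

theorem theorem3 (K L G t Ω δ η : ℕ) (htΩ : t + 1 ≤ Ω) (hΩK : Ω ≤ K)
    (hδ : 0 < δ) (hη : 0 < η) (hdvd : η ∣ δ * S0 t Ω)
    (hbound : (η : ℝ) ≤ min
      ((L : ℝ) * (S0 t Ω : ℝ) / (1 + ((Ω : ℝ) - (t : ℝ) - 1) * (S0 t Ω : ℝ) * (beta0 t Ω : ℝ)))
      ((G : ℝ) / (beta0 t Ω : ℝ))) :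
    Nonempty (DeliveryPlan K t Ω δ) ∧
    ∀ p : DeliveryPlan K t Ω δ,
      -- every transmission consists of XOR codewords of size t + 1 for users of the target set,
      -- and contains exactly η β₀ codewords for each target user
      (∀ (A : TargetSet K Ω) (r : Fin (δ * S0 t Ω / η)),
        (∀ x ∈ p.block η A r, x.2.1 ⊆ A.1 ∧ x.2.1.card = t + 1) ∧
        ∀ k ∈ A.1, ((p.block η A r).filter (fun x => k ∈ x.2.1)).card = η * beta0 t Ω) ∧
      -- almost surely, in every transmission, with suitable transmit beamformers w, each target
      -- user decodes all of these streams with linear receive beamformers u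
      (∀ᵐ H ∂(channelLaw K G L), ∀ (A : TargetSet K Ω) (r : Fin (δ * S0 t Ω / η)),
        ∃ w : Fin δ × CodewordIdx K t → Fin L → ℂ,
          ∀ k ∈ A.1, ∃ u : Fin δ × CodewordIdx K t → Fin G → ℂ,
            ∀ x ∈ p.block η A r, k ∈ x.2.1 →
              DecodesLinearly (Matrix.of (H k)) (p.block η A r) w (u x) x) ∧
      -- different streams carry different subpackets for a user, none of them in its cache
      (∀ k : Fin K, Function.Injective (p.subpacketOf (η := η) (k := k)) ∧
        ∀ y : p.Stream η k, k ∉ (p.subpacketOf y).1.1) ∧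
      -- for all demands, each user obtains from each of its codewords and its cache the subpacket
      -- of its requested file, and from all its codewords and its cache the whole file
      (∀ (N b : ℕ) (dem : Fin K → Fin N) (k : Fin K),
        (∀ y : p.Stream η k,
          ∃ dec : CacheData K N t (numSub K t Ω δ) b k → Bits b → Bits b,
            ∀ W : Fin N → FileData K t (numSub K t Ω δ) b,
              dec (cacheOf W k) (p.codewordOf W dem y) =
                W (dem k) (p.subpacketOf y).1 (p.subpacketOf y).2) ∧
        ∃ dec : CacheData K N t (numSub K t Ω δ) b k → (p.Stream η k → Bits b) →
            FileData K t (numSub K t Ω δ) b,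
          ∀ W : Fin N → FileData K t (numSub K t Ω δ) b,
            dec (cacheOf W k) (fun y => p.codewordOf W dem y) = W (dem k)) := by
  obtain ⟨hL, hG⟩ := le_min_iff.1 hbound
  obtain ⟨X, hX, hXL⟩ := exists_le_mul_S0_add_le htΩ hL
  refine ⟨nonempty_deliveryPlan htΩ hΩK hδ, fun p ↦ ⟨fun A r ↦ ⟨?_, ?_⟩, ?_, fun k ↦
    ⟨p.subpacketOf_injective k, p.notMem_subpacketOf⟩, fun N b dem k ↦
    ⟨p.exists_subpacket_decoder dem, p.exists_file_decoder hdvd dem k⟩⟩⟩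
  · exact fun x hx ↦ ⟨p.subset_of_mem_block hx, x.2.2⟩
  · exact fun k hk ↦ p.card_filter_mem_block hη r hk
  · refine ae_all_iff.2 fun A ↦ ae_all_iff.2 fun r ↦ ?_
    refine (avoidsPolynomialZeros_channelLaw K G L).ae_exists_decodesLinearly
      (mul_beta0_le hG) (fun k hk ↦ p.card_filter_mem_block hη r hk)
      (fun x hx ↦ p.subset_of_mem_block hx) (fun x _ ↦ x.2.2) fun x _ ↦ ?_
    have hcopies := p.card_filter_eq_block_le (A := A) (r := r) hη hX x.2
    simp only [Subtype.ext_iff] at hcopies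
    rw [A.2]
    exact (Nat.add_le_add_left hcopies _).trans hXL
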